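/- **Setting.** Fix $T>0$ and $\alpha,\beta>1/3$; all times lie in $[0,T]$, all functions are real valued and continuous. For $f:[0,T]^2\to\mathbb R$ put $\delta_1f_{s_1s_2t}=f_{s_2t}-f_{s_1t}$, $\delta_2f_{st_1t_2}=f_{st_2}-f_{st_1}$ and $\delta f_{s_1s_2t_1t_2}=f_{s_2t_2}-f_{s_1t_2}-f_{s_2t_1}+f_{s_1t_1}$. On a function of two times, $(\delta g)_{abc}=g_{ac}-g_{ab}-g_{bc}$; $\delta_a$ is $\delta$ applied in direction $a\in\{1,2\}$, $\hat a$ is the other direction, and $\rho_1=\alpha$, $\rho_2=\beta$. For a direction $a$ we write the arguments of direction $a$ first, as $u$'s, and those of direction $\hat a$ last, as $v$'s, also for $x$ (so $x_{uv}$ means $x_{st}$ with $u=s,v=t$ if $a=1$, and with $u=t,v=s$ if $a=2$). We say that $g_{u_1u_2v_1v_2}$ has order $(p,q)$ if $|g_{u_1u_2v_1v_2}|\lesssim|u_2-u_1|^{p\rho_a}|v_2-v_1|^{q\rho_{\hat a}}$ uniformly. $\mathcal{CC}_{1,1}^{\alpha,\beta}$ is the set of $f$ with $|f|\lesssim1$,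 $|\delta_1f_{s_1s_2t}|\lesssim|s_2-s_1|^\alpha$, $|\delta_2f_{st_1t_2}|\lesssim|t_2-t_1|^\beta$, $|\delta f_{s_1s_2t_1t_2}|\lesssim|s_2-s_1|^\alpha|t_2-t_1|^\beta$. **The map $\Lambda_a$.** $g=\Lambda_ah$ means that $g$ is continuous, $\delta_ag=h$ and $|g_{u_1u_2v_1v_2}|\lesssim|u_2-u_1|^\mu$ for some $\mu>1$ (there is at most one such $g$). **Rough sheet.** Let $x\in\mathcal{CC}_{1,1}^{\alpha,\beta}$, and let $i,j$ range over the two letters $x,\omega$. Assume that the following objects are given and satisfy, for all $a,i,j$ and all times, the following relations. (1) Functions $A^x=\delta x$ and $A^\omega$ of order $(1,1)$, $C^{ij}$ of order $(2,2)$, $B_a^{xi}$ of order $(2,1)$; functions $D_a^{ij},E_a^{xij}$ of $(u_1,u_2,u_3,u_4,v_1,v_2)$ with $|D_a^{ij}|\lesssim|u_2-u_1|^{\rho_a}|u_4-u_3|^{\rho_a}|v_2-v_1|^{2\rho_{\hat a}}$ and $|E_a^{xij}|\lesssim|u_2-u_1|^{2\rho_a}|u_4-u_3|^{\rho_a}|v_2-v_1|^{2\rho_{\hat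 a}}$; functions $F_a^{xij}$ of $(u_1,\dots,u_4,v_1,v_2,v_3)$ that are sums $\sum_nh_n$ with $|h_n|\le c_n|u_2-u_1|^{2\rho_a}|u_4-u_3|^{\rho_a}|v_2-v_1|^{\kappa_n}|v_3-v_2|^{3\rho_{\hat a}-\kappa_n}$, $0<\kappa_n<3\rho_{\hat a}$, $\sum_nc_n<\infty$. They satisfy $\delta_aA^\omega=0$; $(\delta_aB_a^{xi})_{u_1u_2u_3v_1v_2}=\delta_ax_{u_1u_2v_1}A^i_{u_2u_3v_1v_2}$; $(\delta_{\hat a}B_a^{xi})_{u_1u_2v_1v_2v_3}=-(D_{\hat a}^{xi})_{v_1v_2v_2v_3u_1u_2}$; $(\delta_aC^{ij})_{u_1u_2u_3v_1v_2}=(D_a^{ij})_{u_1u_2u_2u_3v_1v_2}$; $D_a^{ij}$ and $E_a^{xij}$ have zero $\delta_a$ in the pair $(u_3,u_4)$; $(\delta_{\hat a}D_a^{ij})_{u_1u_2u_3u_4v_1v_2v_3}=A^i_{u_1u_2v_1v_2}A^j_{u_3u_4v_2v_3}$; applying $\delta_a$ to $E_a^{xij}$ in the pair $(u_1,u_2)$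 gives $\delta_ax_{u_1u_2v_1}(D_a^{ij})_{u_2u_3u_4u_5v_1v_2}$; and $(\delta_{\hat a}E_a^{xij})_{u_1u_2u_3u_4v_1v_2v_3}=(F_a^{xij})_{u_1u_2u_3u_4v_1v_2v_3}+(B_a^{xi})_{u_1u_2v_1v_2}A^j_{u_3u_4v_2v_3}$. (2) Functions $G_a$ of order $(1,1)$, $H_a$ and $I_a$ of order $(2,1)$, $J_a$ of order $(2,2)$ with $\delta_aG_a=0$, $\delta_aI_{\hat a}=0$, $(\delta_aH_a)_{u_1u_2u_3v_1v_2}=\delta_ax_{u_1u_2v_1}(G_a)_{u_2u_3v_1v_2}$, $(\delta_aJ_a)_{u_1u_2u_3v_1v_2}=\delta_ax_{u_1u_2v_1}(I_{\hat a})_{v_1v_2u_2u_3}$, $I_a=B_a^{xx}+C^{xx}$, $B_a^{x\omega}=H_a-J_a$, and $$A^\omega=\tfrac12\delta(x^2)-\iint x\,dx=G_a-I_{\hat a},\qquad \iint x\,dx:=xA^x+B_1^{xx}+B_2^{xx}+C^{xx}.$$ (In products such as $xA^x$, the sheet is evaluated at the lower corner $(s_1,t_1)$; also below.) (3) Functions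 $K_a,M_a,N_a$ of order $(2,2)$, $L_a$ of order $(1,2)$, $O_a$ of order $(2,3)$ with $\delta_aL_a=0$ and $(\delta_aK_a)_{u_1u_2u_3v_1v_2}=\delta x_{u_1u_2v_1v_2}\delta x_{u_2u_3v_1v_2}$, $(\delta_aM_a)_{u_1u_2u_3v_1v_2}=\delta_ax_{u_1u_2v_1}(L_a)_{u_2u_3v_1v_2}$, $(\delta_aN_a)_{u_1u_2u_3v_1v_2}=\delta x_{u_1u_2v_1v_2}(G_a)_{u_2u_3v_1v_2}$, $(\delta_aO_a)_{u_1u_2u_3v_1v_2}=\delta x_{u_1u_2v_1v_2}(L_a)_{u_2u_3v_1v_2}$. (4) Functions $(P_a)_{u_1u_2v}$ with $|P_a|\lesssim|u_2-u_1|^{2\rho_a}$ and $Q_a$ of order $(2,1)$ with $(\delta_aP_a)_{u_1u_2u_3v}=\delta_ax_{u_1u_2v}\delta_ax_{u_2u_3v}$; $(P_a)_{u_1u_2v_2}-(P_a)_{u_1u_2v_1}=(B_a^{xx}+Q_a)_{u_1u_2v_1v_2}$; the geometricity relation $P_a=\frac12(\delta_ax)^2$; $(\delta_aQ_a)_{u_1u_2u_3v_1v_2}=\delta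 x_{u_1u_2v_1v_2}\delta_ax_{u_2u_3v_2}$; $\delta_{\hat a}x_{u_1v_1v_2}\delta_ax_{u_1u_2v_2}=(G_a-Q_a)_{u_1u_2v_1v_2}$; and $\delta_{\hat a}x_{u_1v_1v_2}(P_a)_{u_1u_2v_2}=\delta_{\hat a}x_{u_1v_1v_2}(Q_a)_{u_1u_2v_1v_2}+(H_a-Z_a)_{u_1u_2v_1v_2}$, where $Z_a=\Lambda_ah_a$ with $$(h_a)_{u_1u_2u_3v_1v_2}=\delta_ax_{u_1u_2v_1}\delta x_{u_1u_2v_1v_2}\delta_ax_{u_2u_3v_2}+\delta_ax_{u_1u_2v_1}(Q_a)_{u_2u_3v_1v_2}+\delta x_{u_1u_2v_1v_2}(P_a)_{u_2u_3v_2}-\delta x_{u_1u_2v_1v_2}(Q_a)_{u_2u_3v_1v_2}.$$ **Controlled sheets.** $y\in\mathcal Q_x^{\alpha,\beta}$ means that $y$ is continuous and there are $y^{x_1},y^{x_2}\in\mathcal{CC}_{1,1}^{\alpha,\beta}$ such that $\delta_ay_{u_1u_2v}=y^{x_a}_{u_1v}\delta_ax_{u_1u_2v}+y^{\sharp a}_{u_1u_2v}$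 with $|y^{\sharp a}_{u_1u_2v}|\lesssim|u_2-u_1|^{2\rho_a}$ and $|y^{\sharp a}_{u_1u_2v_2}-y^{\sharp a}_{u_1u_2v_1}|\lesssim|u_2-u_1|^{2\rho_a}|v_2-v_1|^{\rho_{\hat a}}$. For such $y$ (with chosen $y^{x_a}$) and $i\in\{x,\omega\}$ put $$\int_ay\int_{\hat a}di:=yA^i+y^{x_a}B_a^{xi}+\Lambda_a\big[y^{\sharp a}A^i+\delta_ay^{x_a}B_a^{xi}\big],$$ where inside the bracket the first factor is taken at $(u_1,u_2,v_1)$ and the second at $(u_2,u_3,v_1,v_2)$. Finally $y\in\mathcal K_x^{\alpha,\beta}$ means that $y\in\mathcal Q_x^{\alpha,\beta}$ and that there are $y^x,y^\omega\in\mathcal Q_x^{\alpha,\beta}$, for which these boundary integrals exist, with $$\delta y=-y^xA^x-y^\omega A^\omega+\sum_{a=1,2}\Big(\int_ay^x\int_{\hat a}dx+\int_ay^\omega\int_{\hat a}d\omega\Big)+y^\sharp,\qquad |y^\sharp_{s_1s_2t_1t_2}|\lesssim|s_2-s_1|^{2\alpha}|t_2-t_1|^{2\beta}.$$ **Theorem.**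 Under the assumptions above, for every $\varphi\in C^5(\mathbb R)$ the sheet $\varphi(x)$ is a controlled sheet: $\varphi(x)\in\mathcal K_x^{\alpha,\beta}$. -/

import Mathlib

/-!
Biincrements on `[0,T]`.  Throughout, `u` denotes the variable in the direction `a` under
consideration and `v` the variable in the other direction.  All notions attached to a direction are
written for "first argument = direction `a`"; for the second coordinate direction they are applied
to the sheet with its two arguments exchanged.
-/

namespace RoughSheet

/-- The time interval `[0,T]`. -/
abbrev Pt (T : ℝ) : Type := Set.Icc (0 : ℝ) T

/-- Functions of one point in each direction (sheets). -/
abbrev Inc11 (T : ℝ) : Type := Pt T → Pt T → ℝ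

/-- Functions of two points in the first direction and one in the second. -/
abbrev Inc21 (T : ℝ) : Type := Pt T → Pt T → Pt T → ℝ

/-- Functions of two points in each direction, in the order `u₁ u₂ v₁ v₂`. -/
abbrev Inc22 (T : ℝ) : Type := Pt T → Pt T → Pt T → Pt T → ℝ

/-- Elements of a split space `(𝒞₂ ⊗ 𝒞₂)(𝒞₂)`: arguments `(u₁ u₂) (u₃ u₄) (v₁ v₂)`. -/
abbrev Inc42 (T : ℝ) : Type := Pt T → Pt T → Pt T → Pt T → Pt T → Pt T → ℝ

/-- Elements of a split space `(𝒞₂ ⊗ 𝒞₂)(𝒞₃)`: arguments `(u₁ u₂) (u₃ u₄) (v₁ v₂ v₃)`. -/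
abbrev Inc43 (T : ℝ) : Type := Pt T → Pt T → Pt T → Pt T → Pt T → Pt T → Pt T → ℝ

variable {T : ℝ}

/-- Exchange the two directions of a sheet. -/
def swap11 (f : Inc11 T) : Inc11 T := fun v u => f u v

/-- Exchange the two directions of a `(2,2)`-biincrement. -/
def swap22 (g : Inc22 T) : Inc22 T := fun v₁ v₂ u₁ u₂ => g u₁ u₂ v₁ v₂

/-! ### Increments and coboundaries -/

/-- Increment of a sheet in its first argument, `f_{u₂ v} - f_{u₁ v}`. -/
def du (f : Inc11 T) (u₁ u₂ v : Pt T) : ℝ := f u₂ v - f u₁ v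

/-- Increment of a sheet in its second argument, `f_{u v₂} - f_{u v₁}`. -/
def dv (f : Inc11 T) (u v₁ v₂ : Pt T) : ℝ := f u v₂ - f u v₁

/-- Rectangular increment `δ f = δ₁ δ₂ f` of a sheet. -/
def drect (f : Inc11 T) : Inc22 T := fun u₁ u₂ v₁ v₂ =>
  f u₂ v₂ - f u₁ v₂ - f u₂ v₁ + f u₁ v₁

/-- Coboundary of a function of two points, `(δ g)_{a b c} = g_{a c} - g_{a b} - g_{b c}`. -/
def cob (g : Pt T → Pt T → ℝ) (a b c : Pt T) : ℝ := g a c - g a b - g b c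

/-! ### Hölder spaces -/

/-- The space `𝒞𝒞_{1,1}^{ρ₁,ρ₂}`: continuous, bounded, with Hölder increments in each direction and
Hölder rectangular increments. -/
def Hol11 (ρ₁ ρ₂ : ℝ) (f : Inc11 T) : Prop :=
  Continuous ↿f ∧
  ∃ C : ℝ,
    (∀ u v, |f u v| ≤ C) ∧
    (∀ u₁ u₂ v, |du f u₁ u₂ v| ≤ C * |(u₂ : ℝ) - u₁| ^ ρ₁) ∧
    (∀ u v₁ v₂, |dv f u v₁ v₂| ≤ C * |(v₂ : ℝ) - v₁| ^ ρ₂) ∧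
    (∀ u₁ u₂ v₁ v₂, |drect f u₁ u₂ v₁ v₂| ≤ C * |(u₂ : ℝ) - u₁| ^ ρ₁ * |(v₂ : ℝ) - v₁| ^ ρ₂)

/-- The space `𝒞𝒞_{2,1}^{ρ₁,ρ₂}`: a `ρ₁`-increment in `u` with values in `ρ₂`-Hölder functions
of `v`. -/
def Hol21 (ρ₁ ρ₂ : ℝ) (g : Inc21 T) : Prop :=
  Continuous ↿g ∧
  ∃ C : ℝ,
    (∀ u₁ u₂ v, |g u₁ u₂ v| ≤ C * |(u₂ : ℝ) - u₁| ^ ρ₁) ∧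
    (∀ u₁ u₂ v₁ v₂,
      |g u₁ u₂ v₂ - g u₁ u₂ v₁| ≤ C * |(u₂ : ℝ) - u₁| ^ ρ₁ * |(v₂ : ℝ) - v₁| ^ ρ₂)

/-- The space `𝒞𝒞_{2,1}^{ρ,*}`: no regularity beyond continuity is required in `v`. -/
def Hol21Star (ρ : ℝ) (g : Inc21 T) : Prop :=
  Continuous ↿g ∧ ∃ C : ℝ, ∀ u₁ u₂ v, |g u₁ u₂ v| ≤ C * |(u₂ : ℝ) - u₁| ^ ρ

/-- The space `𝒞𝒞_{2,2}^{ρ₁,ρ₂}`. -/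
def Hol22 (ρ₁ ρ₂ : ℝ) (g : Inc22 T) : Prop :=
  Continuous ↿g ∧
  ∃ C : ℝ, ∀ u₁ u₂ v₁ v₂,
    |g u₁ u₂ v₁ v₂| ≤ C * |(u₂ : ℝ) - u₁| ^ ρ₁ * |(v₂ : ℝ) - v₁| ^ ρ₂

/-- The space `(𝒞₂^{ρ₁} ⊗ 𝒞₂^{ρ₂})(𝒞₂^{σ})`. -/
def Hol42 (ρ₁ ρ₂ σ : ℝ) (g : Inc42 T) : Prop :=
  Continuous ↿g ∧
  ∃ C : ℝ, ∀ u₁ u₂ u₃ u₄ v₁ v₂,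
    |g u₁ u₂ u₃ u₄ v₁ v₂| ≤
      C * |(u₂ : ℝ) - u₁| ^ ρ₁ * |(u₄ : ℝ) - u₃| ^ ρ₂ * |(v₂ : ℝ) - v₁| ^ σ

/-- The space `(𝒞₂^{ρ₁} ⊗ 𝒞₂^{ρ₂})(𝒞₃^{σ})`: sums of pieces, each of which is split in `v` as
`|v₂ - v₁| ^ κ |v₃ - v₂| ^ (σ - κ)` for some `0 < κ < σ`, with summable constants. -/
def Hol43 (ρ₁ ρ₂ σ : ℝ) (g : Inc43 T) : Prop :=
  Continuous ↿g ∧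
  ∃ (h : ℕ → Inc43 T) (κ C : ℕ → ℝ), Summable C ∧
    (∀ n, 0 < κ n ∧ κ n < σ) ∧
    (∀ n u₁ u₂ u₃ u₄ v₁ v₂ v₃,
      |h n u₁ u₂ u₃ u₄ v₁ v₂ v₃| ≤
        C n * |(u₂ : ℝ) - u₁| ^ ρ₁ * |(u₄ : ℝ) - u₃| ^ ρ₂ *
          (|(v₂ : ℝ) - v₁| ^ (κ n) * |(v₃ : ℝ) - v₂| ^ (σ - κ n))) ∧
    (∀ u₁ u₂ u₃ u₄ v₁ v₂ v₃,
      HasSum (fun n => h n u₁ u₂ u₃ u₄ v₁ v₂ v₃) (g u₁ u₂ u₃ u₄ v₁ v₂ v₃))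

/-! ### The map `Λ` in the first direction -/

/-- The relation `g = Λ h`, where `Λ` inverts the coboundary in the first direction: `g` is an
increment of Hölder order larger than one in the first direction and its coboundary is `h`.
There is at most one such `g`, see `IsLambda.unique`. -/
def IsLambda (h : Pt T → Pt T → Pt T → Pt T → Pt T → ℝ) (g : Inc22 T) : Prop :=
  Continuous ↿g ∧
  (∀ u₁ u₂ u₃ v₁ v₂, cob (fun a b => g a b v₁ v₂) u₁ u₂ u₃ = h u₁ u₂ u₃ v₁ v₂) ∧
  ∃ μ : ℝ, 1 < μ ∧ ∃ C : ℝ, ∀ u₁ u₂ v₁ v₂, |g u₁ u₂ v₁ v₂| ≤ C * |(u₂ : ℝ) - u₁| ^ μ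

/-- `Λ h` is unique: an increment of order larger than one that is additive vanishes. -/
theorem IsLambda.unique {h : Pt T → Pt T → Pt T → Pt T → Pt T → ℝ} {g g' : Inc22 T}
    (hg : IsLambda h g) (hg' : IsLambda h g') : g = g' := by
  obtain ⟨-, hc, μ, hμ, C, hC⟩ := hg
  obtain ⟨-, hc', μ', hμ', C', hC'⟩ := hg'
  funext u₁ u₂ v₁ v₂
  set f : Pt T → Pt T → ℝ := fun a b => g a b v₁ v₂ - g' a b v₁ v₂ with hf
  have hadd : ∀ a b c, f a c = f a b + f b c := fun a b c => by
    have h₁ := hc a b c v₁ v₂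
    have h₂ := hc' a b c v₁ v₂
    simp only [cob] at h₁ h₂
    simp only [hf]
    linarith
  have hbd : ∀ a b, |f a b| ≤ C * |(b : ℝ) - a| ^ μ + C' * |(b : ℝ) - a| ^ μ' := fun a b =>
    (abs_sub _ _).trans (add_le_add (hC a b v₁ v₂) (hC' a b v₁ v₂))
  -- subdivide the segment from `u₁` to `u₂` into `n` equal parts
  have key : ∀ n : ℕ, 0 < n →
      |f u₁ u₂| ≤ n * (C * (|(u₂ : ℝ) - u₁| * (n : ℝ)⁻¹) ^ μ +
        C' * (|(u₂ : ℝ) - u₁| * (n : ℝ)⁻¹) ^ μ') := by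
    intro n hn
    have hn' : (0 : ℝ) < n := by exact_mod_cast hn
    have hmem : ∀ t : ℝ, 0 ≤ t → t ≤ 1 →
        (u₁ : ℝ) + t * ((u₂ : ℝ) - u₁) ∈ Set.Icc (0 : ℝ) T := fun t h0 h1 =>
      (convex_Icc (0 : ℝ) T).add_smul_sub_mem u₁.2 u₂.2 ⟨h0, h1⟩
    have hfrac : ∀ k : ℕ, (0 : ℝ) ≤ min ((k : ℝ) * (n : ℝ)⁻¹) 1 := fun k => by positivity
    let p : ℕ → Pt T := fun k => ⟨_, hmem (min ((k : ℝ) * (n : ℝ)⁻¹) 1) (hfrac k) (min_le_right _ _)⟩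
    have hstep : ∀ k, k ≤ n → |f u₁ (p k)| ≤ k * (C * (|(u₂ : ℝ) - u₁| * (n : ℝ)⁻¹) ^ μ +
        C' * (|(u₂ : ℝ) - u₁| * (n : ℝ)⁻¹) ^ μ') := by
      intro k
      induction k with
      | zero =>
        intro _
        have h0 : p 0 = u₁ := by
          apply Subtype.ext
          simp [p]
        have h1 := hadd u₁ u₁ u₁
        have h2 : f u₁ u₁ = 0 := by linarith
        simp [h0, h2]
      | succ k ih =>
        intro hk
        have hk1 : ((k + 1 : ℕ) : ℝ) * (n : ℝ)⁻¹ ≤ 1 := by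
          rw [← div_eq_mul_inv, div_le_one hn']
          exact_mod_cast hk
        have hk0 : (k : ℝ) * (n : ℝ)⁻¹ ≤ 1 :=
          le_trans (by gcongr; simp) hk1
        have hd : |((p (k + 1) : Pt T) : ℝ) - (p k : Pt T)| = |(u₂ : ℝ) - u₁| * (n : ℝ)⁻¹ := by
          have : ((p (k + 1) : Pt T) : ℝ) - (p k : Pt T) = ((u₂ : ℝ) - u₁) * (n : ℝ)⁻¹ := by
            simp only [p, min_eq_left hk1, min_eq_left hk0]
            push_cast
            ring
          rw [this, abs_mul, abs_of_pos (inv_pos.2 hn')]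
        have h3 := hbd (p k) (p (k + 1))
        rw [hd] at h3
        have h4 := ih (by omega)
        have h5 := abs_add_le (f u₁ (p k)) (f (p k) (p (k + 1)))
        rw [← hadd] at h5
        push_cast
        linarith
    have hlast : p n = u₂ := by
      apply Subtype.ext
      simp [p, hn'.ne']
    simpa [hlast] using hstep n le_rfl
  have hlim : ∀ ν : ℝ, 1 < ν → Filter.Tendsto
      (fun n : ℕ => (n : ℝ) * (|(u₂ : ℝ) - u₁| * (n : ℝ)⁻¹) ^ ν) Filter.atTop (nhds 0) := by
    intro ν hν
    have h1 : Filter.Tendsto (fun n : ℕ => |(u₂ : ℝ) - u₁| ^ ν * (n : ℝ) ^ (-(ν - 1)))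
        Filter.atTop (nhds (|(u₂ : ℝ) - u₁| ^ ν * 0)) :=
      ((tendsto_rpow_neg_atTop (by linarith)).comp tendsto_natCast_atTop_atTop).const_mul _
    rw [mul_zero] at h1
    refine h1.congr' ?_
    filter_upwards [Filter.eventually_gt_atTop 0] with n hn
    have hn' : (0 : ℝ) < n := by exact_mod_cast hn
    rw [Real.mul_rpow (abs_nonneg _) (inv_nonneg.2 hn'.le), Real.inv_rpow hn'.le,
      ← Real.rpow_neg hn'.le, show -(ν - 1) = 1 + -ν by ring, Real.rpow_add hn', Real.rpow_one]
    ring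
  have h0 : |f u₁ u₂| ≤ C * 0 + C' * 0 := by
    refine ge_of_tendsto (((hlim μ hμ).const_mul C).add ((hlim μ' hμ').const_mul C')) ?_
    filter_upwards [Filter.eventually_gt_atTop 0] with n hn
    refine (key n hn).trans (le_of_eq ?_)
    ring
  have h1 : f u₁ u₂ = 0 := abs_nonpos_iff.1 (by simpa using h0)
  simp only [hf] at h1
  linarith

/-! ### The objects making up a rough sheet -/

/-- The two "letters" labelling the measures `dx` and `dω = d₁x d₂x`. -/
inductive Letter : Type
  | x : Letter
  | w : Letter

/-- The objects attached to one direction, written with the arguments of that direction first.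
`B i`, `D i j`, `E i j`, `F i j` stand for `B^{x i}`, `D^{i j}`, `E^{x i j}`, `F^{x i j}`. -/
structure DirData (T : ℝ) where
  B : Letter → Inc22 T
  D : Letter → Letter → Inc42 T
  E : Letter → Letter → Inc42 T
  F : Letter → Letter → Inc43 T
  G : Inc22 T
  H : Inc22 T
  I : Inc22 T
  J : Inc22 T
  K : Inc22 T
  L : Inc22 T
  M : Inc22 T
  N : Inc22 T
  O : Inc22 T
  P : Inc21 T
  Q : Inc22 T

/-- All the objects of a rough sheet: `A i` stands for `A^{i}` and `C i j` for `C^{i j}`, while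
`dir₁` and `dir₂` collect the objects attached to each of the two directions. -/
structure Data (T : ℝ) where
  A : Letter → Inc22 T
  C : Letter → Letter → Inc22 T
  dir₁ : DirData T
  dir₂ : DirData T

/-- The same objects with the two directions exchanged. -/
def Data.swap (X : Data T) : Data T where
  A i := swap22 (X.A i)
  C i j := swap22 (X.C i j)
  dir₁ := X.dir₂
  dir₂ := X.dir₁

/-! ### First group of hypotheses (objects `A` to `F`) -/

/-- The part of the first group of hypotheses that concerns the first direction. -/
structure ChenDir (α β : ℝ) (x : Inc11 T) (X : Data T) : Prop where
  B_mem : ∀ i, Hol22 (2 * α) β (X.dir₁.B i)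
  D_mem : ∀ i j, Hol42 α α (2 * β) (X.dir₁.D i j)
  E_mem : ∀ i j, Hol42 (2 * α) α (2 * β) (X.dir₁.E i j)
  F_mem : ∀ i j, Hol43 (2 * α) α (3 * β) (X.dir₁.F i j)
  /-- `δ_a A^ω = 0` -/
  A_cob : ∀ u₁ u₂ u₃ v₁ v₂, cob (fun a b => X.A .w a b v₁ v₂) u₁ u₂ u₃ = 0
  /-- `δ_a B_a^{x i} = δ_a x A^i` -/
  B_cob : ∀ i u₁ u₂ u₃ v₁ v₂,
    cob (fun a b => X.dir₁.B i a b v₁ v₂) u₁ u₂ u₃ = du x u₁ u₂ v₁ * X.A i u₂ u₃ v₁ v₂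
  /-- `δ_â B_a^{x i} = - μ_â D_â^{x i}` -/
  B_cob_hat : ∀ i u₁ u₂ v₁ v₂ v₃,
    cob (fun a b => X.dir₁.B i u₁ u₂ a b) v₁ v₂ v₃ = - X.dir₂.D .x i v₁ v₂ v₂ v₃ u₁ u₂
  /-- `δ_a C^{i j} = μ_a D_a^{i j}` -/
  C_cob : ∀ i j u₁ u₂ u₃ v₁ v₂,
    cob (fun a b => X.C i j a b v₁ v₂) u₁ u₂ u₃ = X.dir₁.D i j u₁ u₂ u₂ u₃ v₁ v₂
  /-- `(1 ⊗_a δ_a) D_a^{i j} = 0` -/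
  D_cob : ∀ i j u₁ u₂ u₃ u₄ u₅ v₁ v₂,
    cob (fun a b => X.dir₁.D i j u₁ u₂ a b v₁ v₂) u₃ u₄ u₅ = 0
  /-- `δ_â D_a^{i j} = A^i ⊗_a A^j` -/
  D_cob_hat : ∀ i j u₁ u₂ u₃ u₄ v₁ v₂ v₃,
    cob (fun a b => X.dir₁.D i j u₁ u₂ u₃ u₄ a b) v₁ v₂ v₃ =
      X.A i u₁ u₂ v₁ v₂ * X.A j u₃ u₄ v₂ v₃
  /-- `(1 ⊗_a δ_a) E_a^{x i j} = 0` -/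
  E_cob_right : ∀ i j u₁ u₂ u₃ u₄ u₅ v₁ v₂,
    cob (fun a b => X.dir₁.E i j u₁ u₂ a b v₁ v₂) u₃ u₄ u₅ = 0
  /-- `(δ_a ⊗_a 1) E_a^{x i j} = δ_a x ⊗ D_a^{i j}` -/
  E_cob_left : ∀ i j u₁ u₂ u₃ u₄ u₅ v₁ v₂,
    cob (fun a b => X.dir₁.E i j a b u₄ u₅ v₁ v₂) u₁ u₂ u₃ =
      du x u₁ u₂ v₁ * X.dir₁.D i j u₂ u₃ u₄ u₅ v₁ v₂
  /-- `δ_â E_a^{x i j} = F_a^{x i j} + B_a^{x i} ⊗_a A^j` -/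
  E_cob_hat : ∀ i j u₁ u₂ u₃ u₄ v₁ v₂ v₃,
    cob (fun a b => X.dir₁.E i j u₁ u₂ u₃ u₄ a b) v₁ v₂ v₃ =
      X.dir₁.F i j u₁ u₂ u₃ u₄ v₁ v₂ v₃ + X.dir₁.B i u₁ u₂ v₁ v₂ * X.A j u₃ u₄ v₂ v₃

/-- First group of hypotheses. -/
structure Chen (α β : ℝ) (x : Inc11 T) (X : Data T) : Prop where
  A_mem : ∀ i, Hol22 α β (X.A i)
  C_mem : ∀ i j, Hol22 (2 * α) (2 * β) (X.C i j)
  A_x : X.A .x = drect x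
  first : ChenDir α β x X
  second : ChenDir β α (swap11 x) X.swap

/-! ### Second group of hypotheses (objects `G` to `J`) -/

/-- The rough double integral `∬ x dx`.  Since `x` is controlled by itself with constant
coefficients, it is the explicit expression `x A^x + B₁^{xx} + B₂^{xx} + C^{xx}`. -/
def intxdx (x : Inc11 T) (X : Data T) : Inc22 T := fun u₁ u₂ v₁ v₂ =>
  x u₁ v₁ * X.A .x u₁ u₂ v₁ v₂ + X.dir₁.B .x u₁ u₂ v₁ v₂ + X.dir₂.B .x v₁ v₂ u₁ u₂ +
    X.C .x .x u₁ u₂ v₁ v₂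

/-- The part of the second group of hypotheses that concerns the first direction. -/
structure BoundaryAlgDir (α β : ℝ) (x : Inc11 T) (X : Data T) : Prop where
  G_mem : Hol22 α β X.dir₁.G
  H_mem : Hol22 (2 * α) β X.dir₁.H
  I_mem : Hol22 (2 * α) β X.dir₁.I
  J_mem : Hol22 (2 * α) (2 * β) X.dir₁.J
  /-- `δ_a G_a = 0` -/
  G_cob : ∀ u₁ u₂ u₃ v₁ v₂, cob (fun a b => X.dir₁.G a b v₁ v₂) u₁ u₂ u₃ = 0
  /-- `δ_a I_â = 0` -/
  I_cob_hat : ∀ u₁ u₂ u₃ v₁ v₂, cob (fun a b => X.dir₂.I v₁ v₂ a b) u₁ u₂ u₃ = 0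
  /-- `δ_a H_a = δ_a x G_a` -/
  H_cob : ∀ u₁ u₂ u₃ v₁ v₂,
    cob (fun a b => X.dir₁.H a b v₁ v₂) u₁ u₂ u₃ = du x u₁ u₂ v₁ * X.dir₁.G u₂ u₃ v₁ v₂
  /-- `δ_a J_a = δ_a x I_â` -/
  J_cob : ∀ u₁ u₂ u₃ v₁ v₂,
    cob (fun a b => X.dir₁.J a b v₁ v₂) u₁ u₂ u₃ = du x u₁ u₂ v₁ * X.dir₂.I v₁ v₂ u₂ u₃
  /-- `I_a = B_a^{xx} + C^{xx}` -/
  I_eq : ∀ u₁ u₂ v₁ v₂,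
    X.dir₁.I u₁ u₂ v₁ v₂ = X.dir₁.B .x u₁ u₂ v₁ v₂ + X.C .x .x u₁ u₂ v₁ v₂
  /-- `A^ω = G_a - I_â` -/
  A_eq : ∀ u₁ u₂ v₁ v₂, X.A .w u₁ u₂ v₁ v₂ = X.dir₁.G u₁ u₂ v₁ v₂ - X.dir₂.I v₁ v₂ u₁ u₂
  /-- `B_a^{xω} = H_a - J_a` -/
  B_eq : ∀ u₁ u₂ v₁ v₂,
    X.dir₁.B .w u₁ u₂ v₁ v₂ = X.dir₁.H u₁ u₂ v₁ v₂ - X.dir₁.J u₁ u₂ v₁ v₂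

/-- Second group of hypotheses. -/
structure BoundaryAlg (α β : ℝ) (x : Inc11 T) (X : Data T) : Prop where
  /-- `A^ω = ½ δ(x²) - ∬ x dx` -/
  A_w : ∀ u₁ u₂ v₁ v₂,
    X.A .w u₁ u₂ v₁ v₂ =
      1 / 2 * drect (fun u v => x u v ^ 2) u₁ u₂ v₁ v₂ - intxdx x X u₁ u₂ v₁ v₂
  first : BoundaryAlgDir α β x X
  second : BoundaryAlgDir β α (swap11 x) X.swap

/-! ### Third group of hypotheses (objects `K` to `O`) -/

/-- The part of the third group of hypotheses that concerns the first direction. -/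
structure InterpolationAlgDir (α β : ℝ) (x : Inc11 T) (X : Data T) : Prop where
  K_mem : Hol22 (2 * α) (2 * β) X.dir₁.K
  L_mem : Hol22 α (2 * β) X.dir₁.L
  M_mem : Hol22 (2 * α) (2 * β) X.dir₁.M
  N_mem : Hol22 (2 * α) (2 * β) X.dir₁.N
  O_mem : Hol22 (2 * α) (3 * β) X.dir₁.O
  /-- `δ_a K_a = δ x ∘_â δ x` -/
  K_cob : ∀ u₁ u₂ u₃ v₁ v₂,
    cob (fun a b => X.dir₁.K a b v₁ v₂) u₁ u₂ u₃ = drect x u₁ u₂ v₁ v₂ * drect x u₂ u₃ v₁ v₂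
  /-- `δ_a L_a = 0` -/
  L_cob : ∀ u₁ u₂ u₃ v₁ v₂, cob (fun a b => X.dir₁.L a b v₁ v₂) u₁ u₂ u₃ = 0
  /-- `δ_a M_a = δ_a x L_a` -/
  M_cob : ∀ u₁ u₂ u₃ v₁ v₂,
    cob (fun a b => X.dir₁.M a b v₁ v₂) u₁ u₂ u₃ = du x u₁ u₂ v₁ * X.dir₁.L u₂ u₃ v₁ v₂
  /-- `δ_a N_a = δ x ∘_â G_a` -/
  N_cob : ∀ u₁ u₂ u₃ v₁ v₂,
    cob (fun a b => X.dir₁.N a b v₁ v₂) u₁ u₂ u₃ = drect x u₁ u₂ v₁ v₂ * X.dir₁.G u₂ u₃ v₁ v₂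
  /-- `δ_a O_a = δ x ∘_â L_a` -/
  O_cob : ∀ u₁ u₂ u₃ v₁ v₂,
    cob (fun a b => X.dir₁.O a b v₁ v₂) u₁ u₂ u₃ = drect x u₁ u₂ v₁ v₂ * X.dir₁.L u₂ u₃ v₁ v₂

/-- Third group of hypotheses. -/
structure InterpolationAlg (α β : ℝ) (x : Inc11 T) (X : Data T) : Prop where
  first : InterpolationAlgDir α β x X
  second : InterpolationAlgDir β α (swap11 x) X.swap

/-! ### Fourth group of hypotheses (objects `P` and `Q`) -/

/-- The part of the fourth group of hypotheses that concerns the first direction. -/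
structure FinalAlgDir (α β : ℝ) (x : Inc11 T) (X : Data T) : Prop where
  P_mem : Hol21Star (2 * α) X.dir₁.P
  Q_mem : Hol22 (2 * α) β X.dir₁.Q
  /-- `δ_a P_a = δ_a x δ_a x` -/
  P_cob : ∀ u₁ u₂ u₃ v,
    cob (fun a b => X.dir₁.P a b v) u₁ u₂ u₃ = du x u₁ u₂ v * du x u₂ u₃ v
  /-- `δ_â P_a = B_a^{xx} + Q_a` -/
  P_inc_hat : ∀ u₁ u₂ v₁ v₂,
    X.dir₁.P u₁ u₂ v₂ - X.dir₁.P u₁ u₂ v₁ = X.dir₁.B .x u₁ u₂ v₁ v₂ + X.dir₁.Q u₁ u₂ v₁ v₂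
  /-- `P_a = ½ (δ_a x)²`, i.e. the one-dimensional change of variable formula holds for the
  one-dimensional rough paths `(x, P_a)` -/
  P_geom : ∀ u₁ u₂ v, X.dir₁.P u₁ u₂ v = 1 / 2 * du x u₁ u₂ v ^ 2
  /-- `δ_a Q_a = δ x δ_a x` -/
  Q_cob : ∀ u₁ u₂ u₃ v₁ v₂,
    cob (fun a b => X.dir₁.Q a b v₁ v₂) u₁ u₂ u₃ = drect x u₁ u₂ v₁ v₂ * du x u₂ u₃ v₂
  /-- `δ_â x P_a = δ_â x ∘_â Q_a + H_a - Z_a` with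
  `Z_a = Λ_a((δ_a x ∘_a δ x) δ_a x + δ_a x ∘_â Q_a + δ x P_a - δ x ∘_â Q_a)` -/
  H_eq : IsLambda
    (fun u₁ u₂ u₃ v₁ v₂ =>
      du x u₁ u₂ v₁ * drect x u₁ u₂ v₁ v₂ * du x u₂ u₃ v₂ +
        du x u₁ u₂ v₁ * X.dir₁.Q u₂ u₃ v₁ v₂ +
        drect x u₁ u₂ v₁ v₂ * X.dir₁.P u₂ u₃ v₂ -
        drect x u₁ u₂ v₁ v₂ * X.dir₁.Q u₂ u₃ v₁ v₂)
    (fun u₁ u₂ v₁ v₂ =>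
      dv x u₁ v₁ v₂ * X.dir₁.Q u₁ u₂ v₁ v₂ + X.dir₁.H u₁ u₂ v₁ v₂ -
        dv x u₁ v₁ v₂ * X.dir₁.P u₁ u₂ v₂)
  /-- `δ_â x δ_a x = G_a - Q_a` -/
  G_eq : ∀ u₁ u₂ v₁ v₂,
    dv x u₁ v₁ v₂ * du x u₁ u₂ v₂ = X.dir₁.G u₁ u₂ v₁ v₂ - X.dir₁.Q u₁ u₂ v₁ v₂

/-- Fourth group of hypotheses. -/
structure FinalAlg (α β : ℝ) (x : Inc11 T) (X : Data T) : Prop where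
  first : FinalAlgDir α β x X
  second : FinalAlgDir β α (swap11 x) X.swap

/-! ### Controlled sheets -/

/-- `y ∈ 𝒬_x^{α,β}` with coefficients `y₁ = y^{x_1}`, `y₂ = y^{x_2}`, that is,
`δ_a y = y^{x_a} δ_a x + y^{♯a}` for `a = 1, 2`. -/
structure ControlledPath (α β : ℝ) (x y y₁ y₂ : Inc11 T) : Prop where
  cont : Continuous ↿y
  coeff₁ : Hol11 α β y₁
  coeff₂ : Hol11 α β y₂
  sharp₁ : Hol21 (2 * α) β fun s₁ s₂ t => du y s₁ s₂ t - y₁ s₁ t * du x s₁ s₂ t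
  sharp₂ : Hol21 (2 * β) α fun t₁ t₂ s => dv y s t₁ t₂ - y₂ s t₁ * dv x s t₁ t₂

/-- The relation
`Y = ∫_a y ∫_â di = y A^i + y^{x_a} B_a^{x i} + Λ_a [y^{♯a} A^i + δ_a y^{x_a} B_a^{x i}]`
for the first direction, with `y' = y^{x_a}`. -/
def IsBoundaryIntegral (x : Inc11 T) (X : Data T) (i : Letter) (y y' : Inc11 T) (Y : Inc22 T) :
    Prop :=
  IsLambda
    (fun u₁ u₂ u₃ v₁ v₂ =>
      (du y u₁ u₂ v₁ - y' u₁ v₁ * du x u₁ u₂ v₁) * X.A i u₂ u₃ v₁ v₂ +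
        du y' u₁ u₂ v₁ * X.dir₁.B i u₂ u₃ v₁ v₂)
    (fun u₁ u₂ v₁ v₂ =>
      Y u₁ u₂ v₁ v₂ - y u₁ v₁ * X.A i u₁ u₂ v₁ v₂ - y' u₁ v₁ * X.dir₁.B i u₁ u₂ v₁ v₂)

/-- `y ∈ 𝒦_x^{α,β}`: the sheets `y, y^x, y^ω` belong to `𝒬_x^{α,β}`, the four boundary integrals
`Yᵢₐ` below exist, and
`δ y = - y^x A^x - y^ω A^ω + ∑_a (∫_a y^x ∫_â dx + ∫_a y^ω ∫_â dω) + y^♯`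
with `y^♯ ∈ 𝒞𝒞_{2,2}^{2α,2β}`. -/
def ControlledSheet (α β : ℝ) (x : Inc11 T) (X : Data T) (y : Inc11 T) : Prop :=
  (∃ y₁ y₂ : Inc11 T, ControlledPath α β x y y₁ y₂) ∧
  ∃ yx yx₁ yx₂ yw yw₁ yw₂ : Inc11 T,
    ControlledPath α β x yx yx₁ yx₂ ∧
    ControlledPath α β x yw yw₁ yw₂ ∧
    ∃ Yx₁ Yx₂ Yw₁ Yw₂ : Inc22 T,
      IsBoundaryIntegral x X .x yx yx₁ Yx₁ ∧
      IsBoundaryIntegral (swap11 x) X.swap .x (swap11 yx) (swap11 yx₂) (swap22 Yx₂) ∧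
      IsBoundaryIntegral x X .w yw yw₁ Yw₁ ∧
      IsBoundaryIntegral (swap11 x) X.swap .w (swap11 yw) (swap11 yw₂) (swap22 Yw₂) ∧
      Hol22 (2 * α) (2 * β) fun s₁ s₂ t₁ t₂ =>
        drect y s₁ s₂ t₁ t₂ -
          (- yx s₁ t₁ * X.A .x s₁ s₂ t₁ t₂ - yw s₁ t₁ * X.A .w s₁ s₂ t₁ t₂ +
            Yx₁ s₁ s₂ t₁ t₂ + Yx₂ s₁ s₂ t₁ t₂ + Yw₁ s₁ s₂ t₁ t₂ + Yw₂ s₁ s₂ t₁ t₂)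

end RoughSheet

/-!
Write `f = φ'`, and at a corner `x = x_{s₁t₁}` put `a = δ₁x_{s₁s₂t₁}`, `b = δ₂x_{s₁t₁t₂}`,
`d = δx_{s₁s₂t₁t₂}`. Values of derivatives of `φ` without argument are taken at this corner. The
coefficients of `φ(x)` are `y^x = f(x)` and `y^ω = f'(x)`, whose own coefficients are `f'(x)` and
`f''(x)`. The boundary integrals exist by the sewing lemma (`sewing_real`, `exists_isLambda`,
`exists_isLambda_boundary`), and the issue is to see that what remains of `δφ(x)` is of second order
in both directions simultaneously.

By Taylor's formula (`abs_rect_taylor_le`), up to such terms,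
`δφ(x) = δ₁(f(x) δ₂x) + δ₂(f(x) δ₁x) - f d - f' a b`.
Geometricity makes `G` and `A^ω` explicit in terms of `x`, `B` and `C`. Hence, again up to such
terms, the remainder is a sum of two expressions, one for each direction; for the first direction,
with `f^♯ = δ₁f(x) - f' a` and `gˣ`, `g^ω` the `Λ`-parts of the boundary integrals, it is
`W = f^♯ (b + d) - f'' H₁ + f'' b B₁ - gˣ - g^ω` (`dirRemainder`); the term `f'' b B₁`, which is of
second order in both directions, is added for the sake of the coboundary.

The relation `H₁ = ½ a² b + b B₁ + Z₁` shows that `W` has order larger than one in the first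
direction (`exists_abs_dirRemainder_le`), and the algebraic relations show that `δ₁W` has order three
in the first and two in the second direction (`cob_dirRemainder`). An increment of order larger than
one is controlled by its coboundary (`abs_le_of_abs_cob_le`), so `W` has order three in the first and
two in the second direction as well (`hol22_dirRemainder`). The second direction is handled by
exchanging the arguments.
-/

namespace RoughSheet

open Filter Topology Asymptotics

variable {T : ℝ}

/-! ### Taylor estimates -/

/-- Integrating the bound `|g'(q)| ≤ M |q - p| ^ n` along the segment from `p`, where `g` vanishes. -/
theorem abs_le_of_abs_deriv_le_pow {g g' : ℝ → ℝ} {M p : ℝ} {n : ℕ}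
    (hg : ∀ q, HasDerivAt g (g' q) q) (h0 : g p = 0)
    (hM : ∀ q, |g' q| ≤ M * |q - p| ^ n) (hM0 : 0 ≤ M) (q : ℝ) :
    |g q| ≤ M * |q - p| ^ (n + 1) := by
  have h := Convex.norm_image_sub_le_of_norm_hasDerivWithin_le (f := g) (f' := g')
    (s := Set.uIcc p q) (x := p) (y := q) (C := M * |q - p| ^ n)
    (fun r _ => (hg r).hasDerivWithinAt)
    (fun r hr => by
      refine (hM r).trans ?_
      have : |r - p| ≤ |q - p| := by
        rw [abs_sub_comm r p, abs_sub_comm q p]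
        simpa [Real.dist_eq, abs_sub_comm] using Real.dist_left_le_of_mem_uIcc hr
      gcongr)
    (convex_uIcc p q) Set.left_mem_uIcc Set.right_mem_uIcc
  rw [h0, sub_zero, Real.norm_eq_abs, Real.norm_eq_abs] at h
  rw [pow_succ, ← mul_assoc]
  exact h

theorem abs_sub_le_of_abs_deriv_le {f f' : ℝ → ℝ} {M : ℝ} (hf : ∀ q, HasDerivAt f (f' q) q)
    (hM : ∀ q, |f' q| ≤ M) (p q : ℝ) : |f q - f p| ≤ M * |q - p| := by
  have := abs_le_of_abs_deriv_le_pow (g := fun r => f r - f p) (g' := f') (M := M) (p := p) (n := 0)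
    (fun r => (hf r).sub_const _) (by simp) (by simpa using hM) ((abs_nonneg _).trans (hM p)) q
  simpa using this

theorem abs_taylor_one_le {f f' f'' : ℝ → ℝ} {M : ℝ} (hf : ∀ q, HasDerivAt f (f' q) q)
    (hf' : ∀ q, HasDerivAt f' (f'' q) q) (hM : ∀ q, |f'' q| ≤ M) (p a : ℝ) :
    |f (p + a) - f p - f' p * a| ≤ M * |a| ^ 2 := by
  have := abs_le_of_abs_deriv_le_pow (g := fun r => f r - f p - f' p * (r - p))
    (g' := fun r => f' r - f' p) (M := M) (p := p) (n := 1)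
    (fun r => by
      have h := ((hf r).sub_const (f p)).sub (((hasDerivAt_id r).sub_const p).const_mul (f' p))
      exact h.congr_deriv (by simp))
    (by simp) (fun q => by simpa using abs_sub_le_of_abs_deriv_le hf' hM p q)
    ((abs_nonneg _).trans (hM p)) (p + a)
  simpa using this

theorem abs_taylor_two_le {f f' f'' f''' : ℝ → ℝ} {M : ℝ} (hf : ∀ q, HasDerivAt f (f' q) q)
    (hf' : ∀ q, HasDerivAt f' (f'' q) q) (hf'' : ∀ q, HasDerivAt f'' (f''' q) q)
    (hM : ∀ q, |f''' q| ≤ M) (p a : ℝ) :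
    |f (p + a) - f p - f' p * a - 1 / 2 * f'' p * a ^ 2| ≤ M * |a| ^ 3 := by
  have := abs_le_of_abs_deriv_le_pow
    (g := fun r => f r - f p - f' p * (r - p) - 1 / 2 * f'' p * (r - p) ^ 2)
    (g' := fun r => f' r - f' p - f'' p * (r - p)) (M := M) (p := p) (n := 2)
    (fun r => by
      have h := (((hf r).sub_const (f p)).sub
        (((hasDerivAt_id r).sub_const p).const_mul (f' p))).sub
        ((((hasDerivAt_id r).sub_const p).pow 2).const_mul (1 / 2 * f'' p))
      exact h.congr_deriv (by simp; ring))
    (by simp)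
    (fun q => by simpa using abs_taylor_one_le hf' hf'' hM p (q - p))
    ((abs_nonneg _).trans (hM p)) (p + a)
  simpa using this

/-- The second difference of `f` on a quadrilateral with sides `a`, `b` and defect `d`. -/
theorem abs_rect_le {f f' f'' : ℝ → ℝ} {M : ℝ} (hf : ∀ q, HasDerivAt f (f' q) q)
    (hf' : ∀ q, HasDerivAt f' (f'' q) q) (hM' : ∀ q, |f' q| ≤ M) (hM : ∀ q, |f'' q| ≤ M)
    (p a b d : ℝ) :
    |f (p + a + b + d) - f (p + a) - f (p + b) + f p| ≤ M * (|a| * |b| + |d|) := by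
  have h1 := abs_sub_le_of_abs_deriv_le hf hM' (p + a + b) (p + a + b + d)
  have h2 := abs_sub_le_of_abs_deriv_le (f := fun r => f (r + a) - f r)
    (f' := fun r => f' (r + a) - f' r) (M := M * |a|)
    (fun r => ((hf (r + a)).comp_add_const r a).sub (hf r))
    (fun r => by simpa using abs_sub_le_of_abs_deriv_le hf' hM r (r + a)) p (p + b)
  have h3 : f (p + a + b + d) - f (p + a) - f (p + b) + f p =
      (f (p + a + b + d) - f (p + a + b)) + (f (p + b + a) - f (p + b) - (f (p + a) - f p)) := by
    rw [show p + b + a = p + a + b by ring]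
    ring
  rw [h3]
  refine (abs_add_le _ _).trans ((add_le_add h1 h2).trans (le_of_eq ?_))
  simp only [add_sub_cancel_left]
  ring

/-- Variation of the first order Taylor remainder under a change of base point and increment. -/
theorem abs_taylor_one_sub_le {f f' f'' f''' : ℝ → ℝ} {M : ℝ} (hf : ∀ q, HasDerivAt f (f' q) q)
    (hf' : ∀ q, HasDerivAt f' (f'' q) q) (hf'' : ∀ q, HasDerivAt f'' (f''' q) q)
    (hM' : ∀ q, |f'' q| ≤ M) (hM : ∀ q, |f''' q| ≤ M) (p a b d : ℝ) :
    |(f (p + b + (a + d)) - f (p + b) - f' (p + b) * (a + d)) - (f (p + a) - f p - f' p * a)| ≤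
      M * (|a| ^ 2 * |b| + |d| ^ 2 + |a| * |d|) := by
  have h1 := abs_sub_le_of_abs_deriv_le (f := fun r => f (r + a) - f r - f' r * a)
    (f' := fun r => f' (r + a) - f' r - f'' r * a) (M := M * |a| ^ 2)
    (fun r => (((hf (r + a)).comp_add_const r a).sub (hf r)).sub ((hf' r).mul_const a))
    (fun r => abs_taylor_one_le hf' hf'' hM r a) p (p + b)
  have h2 := abs_taylor_one_le hf hf' hM' (p + b + a) d
  have h3 : |(f' (p + b + a) - f' (p + b)) * d| ≤ M * |a| * |d| := by
    rw [abs_mul]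
    gcongr
    simpa using abs_sub_le_of_abs_deriv_le hf' hM' (p + b) (p + b + a)
  have h4 : (f (p + b + (a + d)) - f (p + b) - f' (p + b) * (a + d)) -
      (f (p + a) - f p - f' p * a) =
      (f (p + b + a) - f (p + b) - f' (p + b) * a - (f (p + a) - f p - f' p * a)) +
      (f (p + b + a + d) - f (p + b + a) - f' (p + b + a) * d) +
      (f' (p + b + a) - f' (p + b)) * d := by
    rw [show p + b + (a + d) = p + b + a + d by ring]
    ring
  rw [h4]
  refine (abs_add_le _ _).trans ((add_le_add ((abs_add_le _ _).trans (add_le_add h1 h2)) h3).trans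
    (le_of_eq ?_))
  simp only [add_sub_cancel_left]
  ring

/-- Two-directional Taylor expansion: up to terms that are quadratic in both directions, the second
difference of `f` is the sum of its linearizations in either direction, corrected by what is linear
in both. -/
theorem abs_rect_taylor_le {f f₁ f₂ f₃ f₄ : ℝ → ℝ} {M : ℝ} (hf : ∀ q, HasDerivAt f (f₁ q) q)
    (hf₁ : ∀ q, HasDerivAt f₁ (f₂ q) q) (hf₂ : ∀ q, HasDerivAt f₂ (f₃ q) q)
    (hf₃ : ∀ q, HasDerivAt f₃ (f₄ q) q) (hM₂ : ∀ q, |f₂ q| ≤ M)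
    (hM₃ : ∀ q, |f₃ q| ≤ M) (hM₄ : ∀ q, |f₄ q| ≤ M) (p a b d : ℝ) :
    |(f (p + a + b + d) - f (p + a) - f (p + b) + f p) -
      ((f₁ (p + a) * (b + d) - f₁ p * b) + (f₁ (p + b) * (a + d) - f₁ p * a) -
        f₁ p * d - f₂ p * (a * b))| ≤
      M * (|a| ^ 2 * |b| ^ 2 + |d| ^ 2 + |a| * |b| * |d|) := by
  have h1 := abs_taylor_one_le (f := fun r => f (r + b) - f r - f₁ r * b)
    (f' := fun r => f₁ (r + b) - f₁ r - f₂ r * b)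
    (f'' := fun r => f₂ (r + b) - f₂ r - f₃ r * b) (M := M * |b| ^ 2)
    (fun r => (((hf (r + b)).comp_add_const r b).sub (hf r)).sub ((hf₁ r).mul_const b))
    (fun r => (((hf₁ (r + b)).comp_add_const r b).sub (hf₁ r)).sub ((hf₂ r).mul_const b))
    (fun r => abs_taylor_one_le hf₂ hf₃ hM₄ r b) p a
  have h2 := abs_taylor_one_le hf hf₁ hM₂ (p + a + b) d
  have h3 : |(f₁ (p + a + b + 0) - f₁ (p + a) - f₁ (p + b) + f₁ p) * d| ≤
      M * (|a| * |b| + |(0 : ℝ)|) * |d| := by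
    rw [abs_mul]
    gcongr
    exact abs_rect_le hf₁ hf₂ hM₂ hM₃ p a b 0
  have h4 : (f (p + a + b + d) - f (p + a) - f (p + b) + f p) -
      ((f₁ (p + a) * (b + d) - f₁ p * b) + (f₁ (p + b) * (a + d) - f₁ p * a) -
        f₁ p * d - f₂ p * (a * b)) =
      (f (p + a + b) - f (p + a) - f₁ (p + a) * b - (f (p + b) - f p - f₁ p * b) -
        (f₁ (p + b) - f₁ p - f₂ p * b) * a) +
      (f (p + a + b + d) - f (p + a + b) - f₁ (p + a + b) * d) +
      (f₁ (p + a + b + 0) - f₁ (p + a) - f₁ (p + b) + f₁ p) * d := by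
    rw [add_zero]
    ring
  rw [h4]
  refine (abs_add_le _ _).trans ((add_le_add ((abs_add_le _ _).trans (add_le_add h1 h2)) h3).trans
    (le_of_eq ?_))
  rw [abs_zero]
  ring

/-! ### Halving and the sewing map -/

/-- If halving the length of an increment of order larger than one costs an error `M |h| ^ ν` with
`ν > 1`, the increment is itself of that order, with a constant that involves only `M` and `ν`. -/
theorem abs_le_of_halving {ι : Type*} {F : ι → ℝ → ℝ} {K M μ ν : ℝ} (hμ : 1 < μ) (hν : 1 < ν)
    (hK : ∀ i h, |F i h| ≤ K * |h| ^ μ)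
    (hF : ∀ i h, ∃ j k, |F i h - F j (h / 2) - F k (h / 2)| ≤ M * |h| ^ ν) (i : ι) (h : ℝ) :
    |F i h| ≤ M / (1 - 2 ^ (1 - ν)) * |h| ^ ν := by
  have hq : ∀ κ : ℝ, 1 < κ → (2 : ℝ) ^ (1 - κ) < 1 := fun κ hκ =>
    Real.rpow_lt_one_of_one_lt_of_neg (by norm_num) (by linarith)
  have hpow : ∀ κ h : ℝ, 2 * |h / 2| ^ κ = 2 ^ (1 - κ) * |h| ^ κ := fun κ h => by
    rw [abs_div, abs_two, Real.div_rpow (abs_nonneg _) zero_le_two, Real.rpow_sub two_pos,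
      Real.rpow_one]
    ring
  set q : ℝ := 2 ^ (1 - μ) with hqdef
  set r : ℝ := 2 ^ (1 - ν) with hrdef
  have hq0 : 0 ≤ q := by positivity
  have hr0 : 0 ≤ r := by positivity
  have hr1 : r < 1 := hq ν hν
  have key : ∀ n : ℕ, ∀ i h,
      |F i h| ≤ K * q ^ n * |h| ^ μ + M * (∑ k ∈ Finset.range n, r ^ k) * |h| ^ ν := by
    intro n
    induction n with
    | zero => intro i h; simpa using hK i h
    | succ n ih =>
      intro i h
      obtain ⟨j, k, hjk⟩ := hF i h
      have h1 := ih j (h / 2)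
      have h2 := ih k (h / 2)
      have h3 : |F i h| ≤ M * |h| ^ ν + |F j (h / 2)| + |F k (h / 2)| := by
        have e : F i h = (F i h - F j (h / 2) - F k (h / 2)) + F j (h / 2) + F k (h / 2) := by ring
        rw [e]
        exact (abs_add_le _ _).trans (add_le_add ((abs_add_le _ _).trans
          (add_le_add (by simpa using hjk) (le_of_eq (by congr 1)))) (le_of_eq (by congr 1)))
      refine (h3.trans (add_le_add (add_le_add le_rfl h1) h2)).trans (le_of_eq ?_)
      rw [Finset.sum_range_succ', pow_zero]
      simp only [pow_succ]
      rw [← Finset.sum_mul]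
      linear_combination K * q ^ n * hpow μ h + M * (∑ k ∈ Finset.range n, r ^ k) * hpow ν h
  have hlim : Tendsto (fun n : ℕ =>
      K * q ^ n * |h| ^ μ + M * (∑ k ∈ Finset.range n, r ^ k) * |h| ^ ν) atTop
      (𝓝 (K * 0 * |h| ^ μ + M * (1 - r)⁻¹ * |h| ^ ν)) :=
    (((tendsto_pow_atTop_nhds_zero_of_lt_one hq0 (hq μ hμ)).const_mul K).mul_const _).add
      ((((hasSum_geometric_of_lt_one hr0 hr1).tendsto_sum_nat).const_mul M).mul_const _)
  refine (ge_of_tendsto' hlim fun n => key n i h).trans (le_of_eq ?_)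
  rw [div_eq_mul_inv]
  ring

/-- A function of two times that is additive at midpoints and close, to order larger than one, to
one whose coboundary is of order larger than one, is additive. -/
theorem additive_of_midpoint {S Ξ : ℝ → ℝ → ℝ} {K C θ : ℝ} (hθ : 1 < θ)
    (hmid : ∀ a b, S a b = S a ((a + b) / 2) + S ((a + b) / 2) b)
    (hS : ∀ a b, |S a b - Ξ a b| ≤ K * |b - a| ^ θ)
    (hΞ : ∀ a b c, |Ξ a c - Ξ a b - Ξ b c| ≤ C * (|b - a| + |c - b|) ^ θ)
    (hl : ∀ a, Continuous fun b => S a b) (hr : ∀ b, Continuous fun a => S a b) (a b c : ℝ) :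
    S a c = S a b + S b c := by
  have hθ0 : θ ≠ 0 := by linarith
  have vanish : ∀ F : ℝ → ℝ → ℝ, ∀ K, (∀ a h, |F a h| ≤ K * |h| ^ θ) →
      (∀ a h, ∃ a', F a h = F a (h / 2) + F a' (h / 2)) → ∀ a h, F a h = 0 := by
    intro F K hK hF a h
    have := abs_le_of_halving (M := 0) hθ hθ hK (fun a h => by
      obtain ⟨a', h'⟩ := hF a h
      exact ⟨a, a', by simp [h']⟩) a h
    simpa using this
  -- replacing `S` by `Ξ` in a chain `a, a + h, …, a + N h` and removing the inner points one by one
  have hchain : ∀ N : ℕ, ∃ L, ∀ a h, |(∑ k ∈ Finset.range N, S (a + k * h) (a + (k + 1 : ℕ) * h)) -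
      Ξ a (a + N * h)| ≤ L * |h| ^ θ := by
    intro N
    induction N with
    | zero =>
      refine ⟨0, fun a h => ?_⟩
      have := hΞ a a a
      simpa [Real.zero_rpow hθ0] using this
    | succ N ih =>
      obtain ⟨L, hL⟩ := ih
      refine ⟨L + K + C * (N + 1) ^ θ, fun a h => ?_⟩
      rw [Finset.sum_range_succ]
      have h1 := hL a h
      have h2 := hS (a + N * h) (a + (N + 1 : ℕ) * h)
      have h3 := hΞ a (a + N * h) (a + (N + 1 : ℕ) * h)
      have e2 : |a + (N + 1 : ℕ) * h - (a + N * h)| = |h| := by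
        congr 1; push_cast; ring
      have e3 : |a + N * h - a| = N * |h| := by
        rw [add_sub_cancel_left, abs_mul, Nat.abs_cast]
      rw [e2] at h2 h3
      rw [e3, show (N : ℝ) * |h| + |h| = (N + 1) * |h| by ring,
        Real.mul_rpow (by positivity) (abs_nonneg _)] at h3
      rw [abs_le] at h1 h2 h3 ⊢
      constructor <;> linarith
  have hsum : ∀ (N : ℕ) (a h : ℝ),
      (∑ k ∈ Finset.range N, S (a + k * h) (a + (k + 1 : ℕ) * h)) - S a (a + N * h) = 0 := by
    intro N
    obtain ⟨L, hL⟩ := hchain N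
    refine vanish (fun a h => (∑ k ∈ Finset.range N, S (a + k * h) (a + (k + 1 : ℕ) * h)) -
      S a (a + N * h)) (L + K * N ^ θ) (fun a h => ?_) (fun a h => ⟨a + N * (h / 2), ?_⟩)
    · have h1 := hL a h
      have h2 := hS a (a + N * h)
      rw [add_sub_cancel_left, abs_mul, Nat.abs_cast,
        Real.mul_rpow (by positivity) (abs_nonneg _)] at h2
      rw [abs_le] at h1 h2 ⊢
      constructor <;> linarith
    · have h1 : ∑ k ∈ Finset.range N, S (a + k * h) (a + (k + 1 : ℕ) * h) =
          ∑ k ∈ Finset.range (2 * N), S (a + k * (h / 2)) (a + (k + 1 : ℕ) * (h / 2)) := by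
        have : ∀ n : ℕ, ∑ k ∈ Finset.range n, S (a + k * h) (a + (k + 1 : ℕ) * h) =
            ∑ k ∈ Finset.range (2 * n), S (a + k * (h / 2)) (a + (k + 1 : ℕ) * (h / 2)) := by
          intro n
          induction n with
          | zero => simp
          | succ n ih =>
            rw [Finset.sum_range_succ, ih, show 2 * (n + 1) = 2 * n + 1 + 1 by ring,
              Finset.sum_range_succ, Finset.sum_range_succ, hmid (a + n * h), ← add_assoc]
            have e₀ : a + (2 * n : ℕ) * (h / 2) = a + n * h := by push_cast; ring
            have e₁ : a + (2 * n + 1 : ℕ) * (h / 2) =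
                (a + n * h + (a + (n + 1 : ℕ) * h)) / 2 := by push_cast; ring
            have e₂ : a + (2 * n + 1 + 1 : ℕ) * (h / 2) = a + (n + 1 : ℕ) * h := by
              push_cast; ring
            rw [e₀, e₁, e₂]
        exact this N
      have h2 := hmid a (a + N * h)
      rw [show (a + (a + N * h)) / 2 = a + N * (h / 2) by ring] at h2
      rw [h1, h2, two_mul, Finset.sum_range_add,
        show a + N * h = a + N * (h / 2) + N * (h / 2) by ring]
      have h3 : ∀ k : ℕ, S (a + (N + k : ℕ) * (h / 2)) (a + (N + k + 1 : ℕ) * (h / 2)) =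
          S (a + N * (h / 2) + k * (h / 2)) (a + N * (h / 2) + (k + 1 : ℕ) * (h / 2)) := fun k => by
        congr 1 <;> push_cast <;> ring
      simp only [h3]
      ring
  have hanti : ∀ a b, S a b + S b a = 0 := by
    have := vanish (fun a h => S a (a + h) + S (a + h) a) (2 * K + C * 2 ^ θ) (fun a h => by
      have h1 := hS a (a + h)
      have h2 := hS (a + h) a
      have h3 := hΞ a (a + h) a
      have h4 := hΞ a a a
      rw [add_sub_cancel_left] at h1 h3
      rw [show a - (a + h) = -h by ring, abs_neg] at h2 h3
      rw [← two_mul, Real.mul_rpow zero_le_two (abs_nonneg _)] at h3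
      simp only [sub_self, abs_zero, add_zero, Real.zero_rpow hθ0, mul_zero] at h4
      rw [abs_le] at h1 h2 h3 h4 ⊢
      constructor <;> linarith)
      (fun a h => ⟨a + h / 2, by
        have h1 := hmid a (a + h)
        have h2 := hmid (a + h) a
        rw [show (a + (a + h)) / 2 = a + h / 2 by ring] at h1
        rw [show (a + h + a) / 2 = a + h / 2 by ring] at h2
        rw [show a + h / 2 + h / 2 = a + h by ring]
        linarith⟩)
    intro a b
    simpa using this a (b - a)
  -- additivity at integer, then rational, then (by continuity) real subdivision ratios
  have hnat : ∀ (j k : ℕ) (a h : ℝ),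
      S a (a + (j + k : ℕ) * h) = S a (a + j * h) + S (a + j * h) (a + (j + k : ℕ) * h) := by
    intro j k a h
    have h1 := hsum (j + k) a h
    have h2 := hsum j a h
    have h3 := hsum k (a + j * h) h
    rw [Finset.sum_range_add] at h1
    have h4 : ∀ l : ℕ, S (a + (j + l : ℕ) * h) (a + (j + l + 1 : ℕ) * h) =
        S (a + j * h + l * h) (a + j * h + (l + 1 : ℕ) * h) := fun l => by
      congr 1 <;> push_cast <;> ring
    simp only [h4] at h1
    rw [show a + j * h + k * h = a + (j + k : ℕ) * h by push_cast; ring] at h3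
    linarith
  have hint : ∀ (h : ℝ) (i j k : ℤ), i ≤ j → j ≤ k →
      S (a + i * h) (a + k * h) = S (a + i * h) (a + j * h) + S (a + j * h) (a + k * h) := by
    intro h i j k hij hjk
    obtain ⟨m, rfl⟩ := Int.le.dest hij
    obtain ⟨n, rfl⟩ := Int.le.dest hjk
    have := hnat m n (a + i * h) h
    rw [show a + i * h + (m + n : ℕ) * h = a + (i + m + n : ℤ) * h by push_cast; ring,
      show a + i * h + m * h = a + (i + m : ℤ) * h by push_cast; ring] at this
    exact this
  -- by antisymmetry the order of the three times does not matter
  have hint' : ∀ (h : ℝ) (i j k : ℤ),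
      S (a + i * h) (a + k * h) = S (a + i * h) (a + j * h) + S (a + j * h) (a + k * h) := by
    intro h i j k
    have a1 := hanti (a + i * h) (a + j * h)
    have a2 := hanti (a + j * h) (a + k * h)
    have a3 := hanti (a + i * h) (a + k * h)
    rcases le_total i j with h1 | h1 <;> rcases le_total j k with h2 | h2 <;>
      rcases le_total i k with h3 | h3
    · exact hint h i j k h1 h2
    · exact hint h i j k h1 h2
    · linarith [hint h i k j h3 h2]
    · linarith [hint h k i j h3 h1]
    · linarith [hint h j i k h1 h3]
    · linarith [hint h j k i h2 h3]
    · linarith [hint h k j i h2 h1]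
    · linarith [hint h k j i h2 h1]
  have hrat : ∀ q : ℚ, S a c = S a (a + q * (c - a)) + S (a + q * (c - a)) c := by
    intro q
    have hd : (q.den : ℝ) ≠ 0 := by exact_mod_cast q.den_nz
    have h1 := hint' ((c - a) / q.den) 0 q.num q.den
    have e1 : a + (q.den : ℤ) * ((c - a) / q.den) = c := by
      rw [Int.cast_natCast, mul_div_cancel₀ _ hd]; ring
    have e2 : a + q.num * ((c - a) / q.den) = a + q * (c - a) := by
      rw [Rat.cast_def]; ring
    rw [e1, e2] at h1
    simpa using h1
  have hreal : ∀ t : ℝ, S a c = S a (a + t * (c - a)) + S (a + t * (c - a)) c := by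
    have hc : Continuous fun t : ℝ => a + t * (c - a) := by fun_prop
    have := (Rat.denseRange_cast (𝕜 := ℝ)).equalizer (g := fun _ : ℝ => S a c)
      (h := fun t => S a (a + t * (c - a)) + S (a + t * (c - a)) c) continuous_const
      (((hl a).comp hc).add ((hr c).comp hc)) (funext hrat)
    exact congrFun this
  rcases eq_or_ne a c with rfl | hac
  · linarith [hanti a b, hanti a a]
  · have h1 := hreal ((b - a) / (c - a))
    rw [div_mul_cancel₀ _ (sub_ne_zero.2 hac.symm), add_sub_cancel] at h1
    exact h1

/-- The successive corrections to `Ξ` when the segment from `a` to `b` is halved again and again. -/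
noncomputable def dyadicCorrection {Z : Type*} (Ξ : ℝ → ℝ → Z → ℝ) : ℕ → ℝ → ℝ → Z → ℝ
  | 0, a, b, z => Ξ a ((a + b) / 2) z + Ξ ((a + b) / 2) b z - Ξ a b z
  | n + 1, a, b, z => dyadicCorrection Ξ n a ((a + b) / 2) z +
      dyadicCorrection Ξ n ((a + b) / 2) b z

theorem continuous_dyadicCorrection {Z : Type*} [TopologicalSpace Z] {Ξ : ℝ → ℝ → Z → ℝ}
    (hΞ : Continuous fun p : ℝ × ℝ × Z => Ξ p.1 p.2.1 p.2.2) (n : ℕ) :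
    Continuous fun p : ℝ × ℝ × Z => dyadicCorrection Ξ n p.1 p.2.1 p.2.2 := by
  have h1 : Continuous fun p : ℝ × ℝ × Z => (p.1, (p.1 + p.2.1) / 2, p.2.2) := by fun_prop
  have h2 : Continuous fun p : ℝ × ℝ × Z => ((p.1 + p.2.1) / 2, p.2.1, p.2.2) := by fun_prop
  induction n with
  | zero => exact ((hΞ.comp h1).add (hΞ.comp h2)).sub hΞ
  | succ n ih => exact (ih.comp h1).add (ih.comp h2)

/-- Sewing lemma on the line, with parameters: a function of two times whose coboundary is of order
`θ > 1` becomes additive after adding a continuous function of order `θ`. -/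
theorem sewing_real {Z : Type*} [TopologicalSpace Z] {Ξ : ℝ → ℝ → Z → ℝ} {C θ : ℝ} (hθ : 1 < θ)
    (hcont : Continuous fun p : ℝ × ℝ × Z => Ξ p.1 p.2.1 p.2.2)
    (hΞ : ∀ a b c z, |Ξ a c z - Ξ a b z - Ξ b c z| ≤ C * (|b - a| + |c - b|) ^ θ) :
    ∃ g : ℝ → ℝ → Z → ℝ, Continuous (fun p : ℝ × ℝ × Z => g p.1 p.2.1 p.2.2) ∧
      (∀ a b c z, g a c z - g a b z - g b c z = -(Ξ a c z - Ξ a b z - Ξ b c z)) ∧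
      ∃ K, ∀ a b z, |g a b z| ≤ K * |b - a| ^ θ := by
  set r : ℝ := 2 ^ (1 - θ) with hrdef
  have hr0 : 0 ≤ r := by positivity
  have hr1 : r < 1 := Real.rpow_lt_one_of_one_lt_of_neg (by norm_num) (by linarith)
  have hhalf : ∀ a b : ℝ, |(a + b) / 2 - a| = |b - a| / 2 ∧ |b - (a + b) / 2| = |b - a| / 2 :=
    fun a b => by
      rw [show (a + b) / 2 - a = (b - a) / 2 by ring, show b - (a + b) / 2 = (b - a) / 2 by ring,
        abs_div, abs_two]
      exact ⟨rfl, rfl⟩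
  set D := dyadicCorrection Ξ with hD
  have hDbd : ∀ n a b z, |D n a b z| ≤ r ^ n * (C * |b - a| ^ θ) := by
    intro n
    induction n with
    | zero =>
      intro a b z
      have h1 := hΞ a ((a + b) / 2) b z
      rw [(hhalf a b).1, (hhalf a b).2, add_halves, ← abs_neg] at h1
      rw [pow_zero, one_mul]
      refine (le_of_eq ?_).trans h1
      congr 1
      simp only [hD, dyadicCorrection]
      ring
    | succ n ih =>
      intro a b z
      have h1 := ih a ((a + b) / 2) z
      have h2 := ih ((a + b) / 2) b z
      rw [(hhalf a b).1] at h1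
      rw [(hhalf a b).2] at h2
      refine ((abs_add_le _ _).trans (add_le_add h1 h2)).trans (le_of_eq ?_)
      rw [Real.div_rpow (abs_nonneg _) zero_le_two, pow_succ, hrdef, Real.rpow_sub two_pos,
        Real.rpow_one]
      ring
  have hgeom : Summable fun n : ℕ => r ^ n := summable_geometric_of_lt_one hr0 hr1
  have hsum : ∀ a b z, Summable fun n => D n a b z := fun a b z =>
    Summable.of_norm_bounded (hgeom.mul_right (C * |b - a| ^ θ)) (fun n => hDbd n a b z)
  have hDcont := continuous_dyadicCorrection hcont
  set g : ℝ → ℝ → Z → ℝ := fun a b z => ∑' n, D n a b z with hg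
  have hgc : Continuous (fun p : ℝ × ℝ × Z => g p.1 p.2.1 p.2.2) := by
    rw [continuous_iff_continuousAt]
    intro p
    -- the series converges uniformly on the open set of increments shorter than a given length
    have hopen : IsOpen {q : ℝ × ℝ × Z | |q.2.1 - q.1| < |p.2.1 - p.1| + 1} :=
      isOpen_lt (by fun_prop) continuous_const
    refine (continuousOn_tsum (u := fun n : ℕ => r ^ n * (|C| * (|p.2.1 - p.1| + 1) ^ θ))
      (fun n => (hDcont n).continuousOn) (hgeom.mul_right _) fun n q hq => ?_).continuousAt
      (hopen.mem_nhds (show |p.2.1 - p.1| < |p.2.1 - p.1| + 1 by linarith))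
    have hq' : |q.2.1 - q.1| ≤ |p.2.1 - p.1| + 1 := le_of_lt hq
    refine (hDbd n q.1 q.2.1 q.2.2).trans ?_
    gcongr
    exact le_abs_self C
  have hgbd : ∀ a b z, |g a b z| ≤ (1 - r)⁻¹ * C * |b - a| ^ θ := fun a b z => by
    rw [mul_assoc]
    exact tsum_of_norm_bounded (f := fun n => D n a b z)
      ((hasSum_geometric_of_lt_one hr0 hr1).mul_right _) (fun n => hDbd n a b z)
  refine ⟨g, hgc, fun a b c z => ?_, _, hgbd⟩
  have hslice : ∀ {X : Type} [TopologicalSpace X] {u v : X → ℝ}, Continuous u → Continuous v →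
      Continuous fun t => Ξ (u t) (v t) z + g (u t) (v t) z := fun hu hv =>
    (hcont.comp (hu.prodMk (hv.prodMk continuous_const))).add
      (hgc.comp (hu.prodMk (hv.prodMk continuous_const)))
  have := additive_of_midpoint (S := fun a b => Ξ a b z + g a b z) (Ξ := fun a b => Ξ a b z) hθ
    (fun a b => by
      have h1 : g a b z = D 0 a b z + ∑' n, D (n + 1) a b z := (hsum a b z).tsum_eq_zero_add
      have h2 : ∑' n, D (n + 1) a b z = g a ((a + b) / 2) z + g ((a + b) / 2) b z :=
        (hsum a ((a + b) / 2) z).tsum_add (hsum ((a + b) / 2) b z)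
      have h3 : D 0 a b z = Ξ a ((a + b) / 2) z + Ξ ((a + b) / 2) b z - Ξ a b z := rfl
      linarith)
    (fun a b => by simpa using hgbd a b z) (fun a b c => hΞ a b c z)
    (fun a => hslice continuous_const continuous_id)
    (fun b => hslice continuous_id continuous_const) a b c
  linarith

/-! ### The sewing map on biincrements -/

theorem abs_projIcc_sub_le (hT : 0 ≤ T) (a b : ℝ) :
    |(Set.projIcc 0 T hT b : ℝ) - Set.projIcc 0 T hT a| ≤ |b - a| := by
  rw [Set.coe_projIcc, Set.coe_projIcc]
  exact (abs_max_sub_max_le_max _ _ _ _).trans (by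
    rw [sub_self, abs_zero]
    refine max_le (abs_nonneg _) ((abs_min_sub_min_le_max _ _ _ _).trans ?_)
    rw [sub_self, abs_zero]
    exact max_le (abs_nonneg _) le_rfl)

/-- `Λ h` exists as soon as `-h` is the coboundary of a continuous germ and is of order larger than
one. -/
theorem exists_isLambda (hT : 0 ≤ T) {Ξ : Inc22 T} {h : Pt T → Pt T → Pt T → Pt T → Pt T → ℝ}
    (hΞ : Continuous ↿Ξ)
    (hcob : ∀ u₁ u₂ u₃ v₁ v₂, cob (fun a b => Ξ a b v₁ v₂) u₁ u₂ u₃ = -h u₁ u₂ u₃ v₁ v₂)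
    {C θ : ℝ} (hθ : 1 < θ)
    (hbd : ∀ u₁ u₂ u₃ v₁ v₂,
      |h u₁ u₂ u₃ v₁ v₂| ≤ C * (|(u₂ : ℝ) - u₁| + |(u₃ : ℝ) - u₂|) ^ θ) :
    ∃ g, IsLambda h g := by
  -- composing with the projection onto `[0,T]` extends the germ to the line
  set π := Set.projIcc 0 T hT with hπ
  have hπc : Continuous π := continuous_projIcc
  have hπ' : ∀ u : Pt T, π u = u := fun u => Set.projIcc_val hT u
  obtain ⟨g, hgc, hg, K, hK⟩ := sewing_real (Z := Pt T × Pt T)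
    (Ξ := fun a b z => Ξ (π a) (π b) z.1 z.2) (C := |C|) hθ
    (hΞ.comp ((hπc.comp continuous_fst).prodMk ((hπc.comp (continuous_fst.comp continuous_snd)).prodMk
      (continuous_snd.comp continuous_snd))))
    (fun a b c z => by
      have h1 := hcob (π a) (π b) (π c) z.1 z.2
      simp only [cob] at h1
      rw [h1, abs_neg]
      refine (hbd _ _ _ _ _).trans ?_
      have h2 := abs_projIcc_sub_le hT a b
      have h3 := abs_projIcc_sub_le hT b c
      gcongr
      exact le_abs_self C)
  refine ⟨fun u₁ u₂ v₁ v₂ => g u₁ u₂ (v₁, v₂), ?_, fun u₁ u₂ u₃ v₁ v₂ => ?_, θ, hθ, K,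
    fun u₁ u₂ v₁ v₂ => hK _ _ _⟩
  · exact hgc.comp (f := fun p : Pt T × Pt T × Pt T × Pt T => ((p.1 : ℝ), (p.2.1 : ℝ), p.2.2))
      (by fun_prop)
  · have h1 := hg u₁ u₂ u₃ (v₁, v₂)
    have h2 := hcob u₁ u₂ u₃ v₁ v₂
    simp only [hπ'] at h1
    simp only [cob] at h2 ⊢
    rw [h1, h2, neg_neg]

/-- An increment of order larger than one inherits the order of its coboundary, also as regards the
dependence on the passive variables. -/
theorem abs_le_of_abs_cob_le (hT : 0 ≤ T) {g : Pt T → Pt T → ℝ} {K M μ ν : ℝ} (hμ : 1 < μ)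
    (hν : 1 < ν) (hK : ∀ a b, |g a b| ≤ K * |(b : ℝ) - a| ^ μ)
    (hM : ∀ a b c, |cob g a b c| ≤ M * (|(b : ℝ) - a| + |(c : ℝ) - b|) ^ ν) (hM0 : 0 ≤ M)
    (a b : Pt T) : |g a b| ≤ M / (1 - 2 ^ (1 - ν)) * |(b : ℝ) - a| ^ ν := by
  set π := Set.projIcc 0 T hT with hπ
  have hπ' : ∀ u : Pt T, π u = u := fun u => Set.projIcc_val hT u
  have key := abs_le_of_halving (F := fun a h : ℝ => g (π a) (π (a + h))) (K := |K|) (M := M) hμ hν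
    (fun a h => by
      refine (hK _ _).trans ?_
      have h2 := abs_projIcc_sub_le hT a (a + h)
      rw [add_sub_cancel_left] at h2
      gcongr
      exact le_abs_self K)
    (fun a h => ⟨a, a + h / 2, by
      have h1 := hM (π a) (π (a + h / 2)) (π (a + h))
      have h2 := abs_projIcc_sub_le hT a (a + h / 2)
      have h3 := abs_projIcc_sub_le hT (a + h / 2) (a + h)
      rw [add_sub_cancel_left] at h2
      rw [show a + h - (a + h / 2) = h / 2 by ring] at h3
      have h4 : |h / 2| + |h / 2| = |h| := by rw [abs_div, abs_two]; ring
      rw [add_assoc, add_halves]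
      refine h1.trans ?_
      rw [← h4]
      gcongr⟩) (a : ℝ) ((b : ℝ) - a)
  simpa only [add_sub_cancel, hπ'] using key

/-! ### Orders of increments -/

theorem rpow_two_mul (z ρ : ℝ) : |z| ^ (2 * ρ) = (|z| ^ ρ) ^ 2 := by
  rw [mul_comm, Real.rpow_mul (abs_nonneg z), Real.rpow_two]

theorem rpow_three_mul {z : ℝ} (hz : 0 ≤ z) (ρ : ℝ) : z ^ (3 * ρ) = (z ^ ρ) ^ 3 := by
  rw [mul_comm, Real.rpow_mul hz]
  exact_mod_cast Real.rpow_natCast (z ^ ρ) 3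

/-- Orders of increments can be lowered, since the time interval is bounded. -/
theorem isBigO_rpow_of_le {ι : Type*} (u₁ u₂ : ι → Pt T) {μ ν : ℝ} (hμ : 0 < μ) (h : μ ≤ ν) :
    (fun i => |(u₂ i : ℝ) - u₁ i| ^ ν) =O[⊤] fun i => |(u₂ i : ℝ) - u₁ i| ^ μ := by
  refine isBigO_top.2 ⟨T ^ (ν - μ), fun i => ?_⟩
  have h1 : |(u₂ i : ℝ) - u₁ i| ≤ T := by
    have h1 := (u₁ i).2
    have h2 := (u₂ i).2
    rw [abs_le]
    constructor <;> linarith [h1.1, h1.2, h2.1, h2.2]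
  rw [Real.norm_of_nonneg (by positivity), Real.norm_of_nonneg (by positivity),
    show |(u₂ i : ℝ) - u₁ i| ^ ν = |(u₂ i : ℝ) - u₁ i| ^ (ν - μ + μ) by ring_nf,
    Real.rpow_add_of_nonneg (abs_nonneg _) (by linarith) hμ.le]
  gcongr

theorem isBigO_rpow_one {ι : Type*} (u₁ u₂ : ι → Pt T) {ν : ℝ} (h : 0 ≤ ν) :
    (fun i => |(u₂ i : ℝ) - u₁ i| ^ ν) =O[⊤] fun _ => (1 : ℝ) := by
  refine isBigO_top.2 ⟨T ^ ν, fun i => ?_⟩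
  have h1 : |(u₂ i : ℝ) - u₁ i| ≤ T := by
    have h1 := (u₁ i).2
    have h2 := (u₂ i).2
    rw [abs_le]
    constructor <;> linarith [h1.1, h1.2, h2.1, h2.2]
  rw [Real.norm_of_nonneg (by positivity), norm_one, mul_one]
  gcongr

section IsBigO

variable {ι : Type*} {ρ₁ ρ₂ : ℝ}

theorem Hol11.isBigO_one {f : Inc11 T} (h : Hol11 ρ₁ ρ₂ f) (u v : ι → Pt T) :
    (fun i => f (u i) (v i)) =O[⊤] fun _ => (1 : ℝ) := by
  obtain ⟨-, C, hC, -⟩ := h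
  exact isBigO_top.2 ⟨C, fun i => by simpa using hC (u i) (v i)⟩

theorem Hol11.isBigO_du {f : Inc11 T} (h : Hol11 ρ₁ ρ₂ f) (u₁ u₂ v : ι → Pt T) :
    (fun i => du f (u₁ i) (u₂ i) (v i)) =O[⊤] fun i => |(u₂ i : ℝ) - u₁ i| ^ ρ₁ := by
  obtain ⟨-, C, -, hC, -⟩ := h
  refine isBigO_top.2 ⟨C, fun i => ?_⟩
  rw [Real.norm_of_nonneg (by positivity : 0 ≤ |(u₂ i : ℝ) - u₁ i| ^ ρ₁)]
  exact hC _ _ _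

theorem Hol11.isBigO_dv {f : Inc11 T} (h : Hol11 ρ₁ ρ₂ f) (u v₁ v₂ : ι → Pt T) :
    (fun i => dv f (u i) (v₁ i) (v₂ i)) =O[⊤] fun i => |(v₂ i : ℝ) - v₁ i| ^ ρ₂ := by
  obtain ⟨-, C, -, -, hC, -⟩ := h
  refine isBigO_top.2 ⟨C, fun i => ?_⟩
  rw [Real.norm_of_nonneg (by positivity : 0 ≤ |(v₂ i : ℝ) - v₁ i| ^ ρ₂)]
  exact hC _ _ _

theorem Hol11.isBigO_drect {f : Inc11 T} (h : Hol11 ρ₁ ρ₂ f) (u₁ u₂ v₁ v₂ : ι → Pt T) :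
    (fun i => drect f (u₁ i) (u₂ i) (v₁ i) (v₂ i)) =O[⊤]
      fun i => |(u₂ i : ℝ) - u₁ i| ^ ρ₁ * |(v₂ i : ℝ) - v₁ i| ^ ρ₂ := by
  obtain ⟨-, C, -, -, -, hC⟩ := h
  refine isBigO_top.2 ⟨C, fun i => ?_⟩
  rw [Real.norm_of_nonneg (by positivity :
    0 ≤ |(u₂ i : ℝ) - u₁ i| ^ ρ₁ * |(v₂ i : ℝ) - v₁ i| ^ ρ₂), ← mul_assoc]
  exact hC _ _ _ _

theorem Hol21.isBigO {g : Inc21 T} (h : Hol21 ρ₁ ρ₂ g) (u₁ u₂ v : ι → Pt T) :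
    (fun i => g (u₁ i) (u₂ i) (v i)) =O[⊤] fun i => |(u₂ i : ℝ) - u₁ i| ^ ρ₁ := by
  obtain ⟨-, C, hC, -⟩ := h
  refine isBigO_top.2 ⟨C, fun i => ?_⟩
  rw [Real.norm_of_nonneg (by positivity : 0 ≤ |(u₂ i : ℝ) - u₁ i| ^ ρ₁)]
  exact hC _ _ _

theorem Hol22.isBigO {g : Inc22 T} (h : Hol22 ρ₁ ρ₂ g) (u₁ u₂ v₁ v₂ : ι → Pt T) :
    (fun i => g (u₁ i) (u₂ i) (v₁ i) (v₂ i)) =O[⊤]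
      fun i => |(u₂ i : ℝ) - u₁ i| ^ ρ₁ * |(v₂ i : ℝ) - v₁ i| ^ ρ₂ := by
  obtain ⟨-, C, hC⟩ := h
  refine isBigO_top.2 ⟨C, fun i => ?_⟩
  rw [Real.norm_of_nonneg (by positivity :
    0 ≤ |(u₂ i : ℝ) - u₁ i| ^ ρ₁ * |(v₂ i : ℝ) - v₁ i| ^ ρ₂), ← mul_assoc]
  exact hC _ _ _ _

theorem hol22_of_isBigO {g : Inc22 T} (hc : Continuous ↿g)
    (h : (fun p : Pt T × Pt T × Pt T × Pt T => g p.1 p.2.1 p.2.2.1 p.2.2.2) =O[⊤]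
      fun p => |(p.2.1 : ℝ) - p.1| ^ ρ₁ * |(p.2.2.2 : ℝ) - p.2.2.1| ^ ρ₂) : Hol22 ρ₁ ρ₂ g := by
  obtain ⟨C, hC⟩ := isBigO_top.1 h
  refine ⟨hc, C, fun u₁ u₂ v₁ v₂ => ?_⟩
  have h1 := hC (u₁, u₂, v₁, v₂)
  rw [Real.norm_of_nonneg (by positivity :
    0 ≤ |(u₂ : ℝ) - u₁| ^ ρ₁ * |(v₂ : ℝ) - v₁| ^ ρ₂), ← mul_assoc] at h1
  exact h1

end IsBigO

theorem Hol11.swap {ρ₁ ρ₂ : ℝ} {f : Inc11 T} (h : Hol11 ρ₁ ρ₂ f) : Hol11 ρ₂ ρ₁ (swap11 f) := by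
  obtain ⟨hc, C, h0, h1, h2, h3⟩ := h
  refine ⟨hc.comp continuous_swap, C, fun v u => h0 u v, fun v₁ v₂ u => h2 u v₁ v₂,
    fun v u₁ u₂ => h1 u₁ u₂ v, fun v₁ v₂ u₁ u₂ => ?_⟩
  refine (le_of_eq ?_).trans ((h3 u₁ u₂ v₁ v₂).trans (le_of_eq (by ring)))
  simp only [drect, swap11]
  congr 1
  ring

/-! ### Composition with smooth functions -/

/-- Functions of class `C ^ n` with compact support; they are bounded with their derivatives. -/
def SmoothCompact (n : ℕ) (f : ℝ → ℝ) : Prop := ContDiff ℝ n f ∧ HasCompactSupport f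

namespace SmoothCompact

variable {n : ℕ} {f : ℝ → ℝ}

theorem deriv (h : SmoothCompact (n + 1) f) : SmoothCompact n (deriv f) :=
  ⟨((contDiff_succ_iff_deriv (n := (n : WithTop ℕ∞))).1 (by exact_mod_cast h.1)).2.2, h.2.deriv⟩

theorem hasDerivAt (h : SmoothCompact (n + 1) f) (q : ℝ) : HasDerivAt f (_root_.deriv f q) q :=
  (((contDiff_succ_iff_deriv (n := (n : WithTop ℕ∞))).1 (by exact_mod_cast h.1)).1 q).hasDerivAt

theorem continuous (h : SmoothCompact n f) : Continuous f := h.1.continuous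

theorem mono {m : ℕ} (h : SmoothCompact n f) (hmn : m ≤ n) : SmoothCompact m f :=
  ⟨h.1.of_le (by exact_mod_cast hmn), h.2⟩

theorem exists_bound (h : SmoothCompact n f) : ∃ M, ∀ q, |f q| ≤ M :=
  h.2.exists_bound_of_continuous h.continuous

end SmoothCompact

theorem Hol11.comp {α β : ℝ} {x : Inc11 T} (hx : Hol11 α β x) {f : ℝ → ℝ}
    (hf : SmoothCompact 2 f) : Hol11 α β fun u v => f (x u v) := by
  obtain ⟨hc, C, -, h1, h2, h3⟩ := hx
  obtain ⟨M₀, hM₀⟩ := hf.exists_bound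
  obtain ⟨M₁, hM₁⟩ := hf.deriv.exists_bound
  obtain ⟨M₂, hM₂⟩ := hf.deriv.deriv.exists_bound
  set M := max M₁ M₂
  have hM : 0 ≤ M := ((abs_nonneg _).trans (hM₁ 0)).trans (le_max_left _ _)
  have hle : ∀ p q, |f q - f p| ≤ M * |q - p| :=
    abs_sub_le_of_abs_deriv_le hf.hasDerivAt fun q => (hM₁ q).trans (le_max_left _ _)
  refine ⟨hf.continuous.comp hc, max M₀ (max (M * |C|) (M * (|C| * |C| + |C|))),
    fun u v => (hM₀ _).trans (le_max_left _ _), fun u₁ u₂ v => ?_, fun u v₁ v₂ => ?_,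
    fun u₁ u₂ v₁ v₂ => ?_⟩
  · calc |du (fun u v => f (x u v)) u₁ u₂ v| ≤ M * |du x u₁ u₂ v| := hle _ _
      _ ≤ M * (|C| * |(u₂ : ℝ) - u₁| ^ α) := by
        gcongr
        exact (h1 _ _ _).trans (by gcongr; exact le_abs_self C)
      _ = M * |C| * |(u₂ : ℝ) - u₁| ^ α := by ring
      _ ≤ _ := by
        gcongr
        exact (le_max_left _ _).trans (le_max_right _ _)
  · calc |dv (fun u v => f (x u v)) u v₁ v₂| ≤ M * |dv x u v₁ v₂| := hle _ _
      _ ≤ M * (|C| * |(v₂ : ℝ) - v₁| ^ β) := by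
        gcongr
        exact (h2 _ _ _).trans (by gcongr; exact le_abs_self C)
      _ = M * |C| * |(v₂ : ℝ) - v₁| ^ β := by ring
      _ ≤ _ := by
        gcongr
        exact (le_max_left _ _).trans (le_max_right _ _)
  · have h := abs_rect_le hf.hasDerivAt hf.deriv.hasDerivAt
      (fun q => (hM₁ q).trans (le_max_left M₁ M₂)) (fun q => (hM₂ q).trans (le_max_right M₁ M₂))
      (x u₁ v₁) (du x u₁ u₂ v₁) (dv x u₁ v₁ v₂) (drect x u₁ u₂ v₁ v₂)
    have e1 : x u₁ v₁ + du x u₁ u₂ v₁ + dv x u₁ v₁ v₂ + drect x u₁ u₂ v₁ v₂ = x u₂ v₂ := by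
      simp only [du, dv, drect]; ring
    have e2 : x u₁ v₁ + du x u₁ u₂ v₁ = x u₂ v₁ := by simp only [du]; ring
    have e3 : x u₁ v₁ + dv x u₁ v₁ v₂ = x u₁ v₂ := by simp only [dv]; ring
    rw [e1, e2, e3] at h
    calc |drect (fun u v => f (x u v)) u₁ u₂ v₁ v₂| =
          |f (x u₂ v₂) - f (x u₂ v₁) - f (x u₁ v₂) + f (x u₁ v₁)| := by
          simp only [drect]; congr 1; ring
      _ ≤ M * (|du x u₁ u₂ v₁| * |dv x u₁ v₁ v₂| + |drect x u₁ u₂ v₁ v₂|) := h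
      _ ≤ M * ((|C| * |(u₂ : ℝ) - u₁| ^ α) * (|C| * |(v₂ : ℝ) - v₁| ^ β) +
          |C| * |(u₂ : ℝ) - u₁| ^ α * |(v₂ : ℝ) - v₁| ^ β) := by
        gcongr
        · exact (h1 _ _ _).trans (by gcongr; exact le_abs_self C)
        · exact (h2 _ _ _).trans (by gcongr; exact le_abs_self C)
        · exact (h3 _ _ _ _).trans (by gcongr; exact le_abs_self C)
      _ = M * (|C| * |C| + |C|) * |(u₂ : ℝ) - u₁| ^ α * |(v₂ : ℝ) - v₁| ^ β := by ring
      _ ≤ _ := by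
        gcongr
        exact (le_max_right _ _).trans (le_max_right _ _)

/-- The remainder `y^♯` of `y = f(x)` is a first order Taylor remainder of `f`. -/
theorem Hol11.sharp_comp {α β : ℝ} {x : Inc11 T} (hx : Hol11 α β x) {f : ℝ → ℝ}
    (hf : SmoothCompact 3 f) :
    Hol21 (2 * α) β fun u₁ u₂ v =>
      du (fun u v => f (x u v)) u₁ u₂ v - deriv f (x u₁ v) * du x u₁ u₂ v := by
  obtain ⟨hc, C, -, h1, h2, h3⟩ := hx
  obtain ⟨M₁, hM₁⟩ := hf.deriv.deriv.exists_bound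
  obtain ⟨M₂, hM₂⟩ := hf.deriv.deriv.deriv.exists_bound
  set M := max M₁ M₂
  have hM : 0 ≤ M := ((abs_nonneg _).trans (hM₁ 0)).trans (le_max_left _ _)
  have hM₁' : ∀ q, |deriv (deriv f) q| ≤ M := fun q => (hM₁ q).trans (le_max_left _ _)
  have e1 : ∀ u₁ u₂ v, x u₁ v + du x u₁ u₂ v = x u₂ v := fun u₁ u₂ v => by
    simp only [du]; ring
  have h1' : ∀ u₁ u₂ v, |du x u₁ u₂ v| ≤ |C| * |(u₂ : ℝ) - u₁| ^ α := fun u₁ u₂ v =>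
    (h1 _ _ _).trans (by gcongr; exact le_abs_self C)
  have h2' : ∀ u v₁ v₂, |dv x u v₁ v₂| ≤ |C| * |(v₂ : ℝ) - v₁| ^ β := fun u v₁ v₂ =>
    (h2 _ _ _).trans (by gcongr; exact le_abs_self C)
  refine ⟨?_, max (M * |C| ^ 2) (M * (|C| ^ 3 + 3 * |C| ^ 2)), ?_, ?_⟩
  · have hcf := hf.continuous
    have hcf' := hf.deriv.continuous
    have hx' : ∀ {u v : Pt T × Pt T × Pt T → Pt T}, Continuous u → Continuous v →
        Continuous fun p => x (u p) (v p) := fun hu hv => hc.comp (hu.prodMk hv)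
    have k1 := hx' (continuous_fst.comp continuous_snd) (continuous_snd.comp continuous_snd)
    have k2 := hx' continuous_fst (continuous_snd.comp continuous_snd)
    exact ((hcf.comp k1).sub (hcf.comp k2)).sub ((hcf'.comp k2).mul (k1.sub k2))
  · intro u₁ u₂ v
    have h := abs_taylor_one_le hf.hasDerivAt hf.deriv.hasDerivAt hM₁' (x u₁ v) (du x u₁ u₂ v)
    rw [e1] at h
    calc _ ≤ M * |du x u₁ u₂ v| ^ 2 := h
      _ ≤ M * (|C| * |(u₂ : ℝ) - u₁| ^ α) ^ 2 := by gcongr; exact h1' _ _ _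
      _ = M * |C| ^ 2 * |(u₂ : ℝ) - u₁| ^ (2 * α) := by rw [rpow_two_mul]; ring
      _ ≤ _ := by gcongr; exact le_max_left _ _
  · intro u₁ u₂ v₁ v₂
    have h := abs_taylor_one_sub_le hf.hasDerivAt hf.deriv.hasDerivAt hf.deriv.deriv.hasDerivAt
      hM₁' (fun q => (hM₂ q).trans (le_max_right M₁ M₂))
      (x u₁ v₁) (du x u₁ u₂ v₁) (dv x u₁ v₁ v₂) (drect x u₁ u₂ v₁ v₂)
    have e2 : x u₁ v₁ + dv x u₁ v₁ v₂ = x u₁ v₂ := by simp only [dv]; ring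
    have e3 : du x u₁ u₂ v₁ + drect x u₁ u₂ v₁ v₂ = du x u₁ u₂ v₂ := by
      simp only [du, drect]; ring
    rw [e2, e3, e1, e1] at h
    have k1 := h1' u₁ u₂ v₁
    have k2 := h2' u₁ v₁ v₂
    have k3 : |drect x u₁ u₂ v₁ v₂| ≤ |C| * |(u₂ : ℝ) - u₁| ^ α * |(v₂ : ℝ) - v₁| ^ β :=
      (h3 _ _ _ _).trans (by gcongr; exact le_abs_self C)
    -- the square of the rectangular increment needs the decay in `v` in only one of its factors
    have k4 : |drect x u₁ u₂ v₁ v₂| ≤ 2 * (|C| * |(u₂ : ℝ) - u₁| ^ α) := by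
      rw [← sub_eq_iff_eq_add'.2 e3.symm]
      refine (abs_sub _ _).trans ?_
      linarith [h1' u₁ u₂ v₁, h1' u₁ u₂ v₂]
    calc _ ≤ M * (|du x u₁ u₂ v₁| ^ 2 * |dv x u₁ v₁ v₂| +
          |drect x u₁ u₂ v₁ v₂| * |drect x u₁ u₂ v₁ v₂| +
          |du x u₁ u₂ v₁| * |drect x u₁ u₂ v₁ v₂|) := by rw [← pow_two]; exact h
      _ ≤ M * ((|C| * |(u₂ : ℝ) - u₁| ^ α) ^ 2 * (|C| * |(v₂ : ℝ) - v₁| ^ β) +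
          2 * (|C| * |(u₂ : ℝ) - u₁| ^ α) *
            (|C| * |(u₂ : ℝ) - u₁| ^ α * |(v₂ : ℝ) - v₁| ^ β) +
          |C| * |(u₂ : ℝ) - u₁| ^ α * (|C| * |(u₂ : ℝ) - u₁| ^ α * |(v₂ : ℝ) - v₁| ^ β)) := by
        gcongr
      _ = M * (|C| ^ 3 + 3 * |C| ^ 2) * |(u₂ : ℝ) - u₁| ^ (2 * α) * |(v₂ : ℝ) - v₁| ^ β := by
        rw [rpow_two_mul]; ring
      _ ≤ _ := by gcongr; exact le_max_right _ _

theorem Hol11.controlledPath_comp {α β : ℝ} {x : Inc11 T} (hx : Hol11 α β x) {f : ℝ → ℝ}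
    (hf : SmoothCompact 3 f) :
    ControlledPath α β x (fun u v => f (x u v)) (fun u v => deriv f (x u v))
      (fun u v => deriv f (x u v)) where
  cont := hf.continuous.comp hx.1
  coeff₁ := hx.comp hf.deriv
  coeff₂ := hx.comp hf.deriv
  sharp₁ := hx.sharp_comp hf
  sharp₂ := hx.swap.sharp_comp hf

/-! ### Boundary integrals -/

theorem rpow_isBigO_left {ι : Type*} (u₁ u₂ u₃ : ι → Pt T) {ρ : ℝ} (h : 0 ≤ ρ) :
    (fun i => |(u₂ i : ℝ) - u₁ i| ^ ρ) =O[⊤]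
      fun i => (|(u₂ i : ℝ) - u₁ i| + |(u₃ i : ℝ) - u₂ i|) ^ ρ :=
  isBigO_of_le _ fun i => by
    rw [Real.norm_of_nonneg (by positivity), Real.norm_of_nonneg (by positivity)]
    gcongr
    linarith [abs_nonneg ((u₃ i : ℝ) - u₂ i)]

theorem rpow_isBigO_right {ι : Type*} (u₁ u₂ u₃ : ι → Pt T) {ρ : ℝ} (h : 0 ≤ ρ) :
    (fun i => |(u₃ i : ℝ) - u₂ i| ^ ρ) =O[⊤]
      fun i => (|(u₂ i : ℝ) - u₁ i| + |(u₃ i : ℝ) - u₂ i|) ^ ρ :=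
  isBigO_of_le _ fun i => by
    rw [Real.norm_of_nonneg (by positivity), Real.norm_of_nonneg (by positivity)]
    gcongr
    linarith [abs_nonneg ((u₂ i : ℝ) - u₁ i)]

/-- The boundary integrals of a controlled path exist: the germ `y A + y' B` is sewn. -/
theorem exists_isLambda_boundary (hT : 0 ≤ T) {α β : ℝ} (hα : 1 / 3 < α) (hβ : 0 < β)
    {x y y' : Inc11 T} (hy : Continuous ↿y) (hy' : Hol11 α β y')
    (hsharp : Hol21 (2 * α) β fun u₁ u₂ v => du y u₁ u₂ v - y' u₁ v * du x u₁ u₂ v)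
    {A B : Inc22 T} (hA : Hol22 α β A) (hB : Hol22 (2 * α) β B)
    (hAcob : ∀ u₁ u₂ u₃ v₁ v₂, cob (fun a b => A a b v₁ v₂) u₁ u₂ u₃ = 0)
    (hBcob : ∀ u₁ u₂ u₃ v₁ v₂,
      cob (fun a b => B a b v₁ v₂) u₁ u₂ u₃ = du x u₁ u₂ v₁ * A u₂ u₃ v₁ v₂) :
    ∃ g, IsLambda (fun u₁ u₂ u₃ v₁ v₂ =>
      (du y u₁ u₂ v₁ - y' u₁ v₁ * du x u₁ u₂ v₁) * A u₂ u₃ v₁ v₂ +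
        du y' u₁ u₂ v₁ * B u₂ u₃ v₁ v₂) g := by
  have hα0 : 0 ≤ α := by linarith
  let ι := Pt T × Pt T × Pt T × Pt T × Pt T
  let u₁ : ι → Pt T := fun i => i.1
  let u₂ : ι → Pt T := fun i => i.2.1
  let u₃ : ι → Pt T := fun i => i.2.2.1
  let v₁ : ι → Pt T := fun i => i.2.2.2.1
  let v₂ : ι → Pt T := fun i => i.2.2.2.2
  let s : ι → ℝ := fun i => (|(u₂ i : ℝ) - u₁ i| + |(u₃ i : ℝ) - u₂ i|) ^ α
  have hV := isBigO_rpow_one v₁ v₂ hβ.le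
  have hl := rpow_isBigO_left u₁ u₂ u₃ hα0
  have hr := rpow_isBigO_right u₁ u₂ u₃ hα0
  have b1 := (hsharp.isBigO u₁ u₂ v₁).trans
    ((hl.pow 2).congr_left fun i => (rpow_two_mul _ _).symm)
  have b2 := (hA.isBigO u₂ u₃ v₁ v₂).trans (hr.mul hV)
  have b3 := (hy'.isBigO_du u₁ u₂ v₁).trans hl
  have b4 := (hB.isBigO u₂ u₃ v₁ v₂).trans
    (((hr.pow 2).congr_left fun i => (rpow_two_mul _ _).symm).mul hV)
  have b5 := ((b1.mul b2).congr_right (g₂ := fun i => s i ^ 3) fun i => by ring).add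
    ((b3.mul b4).congr_right (g₂ := fun i => s i ^ 3) fun i => by ring)
  obtain ⟨C, hC⟩ := isBigO_top.1 b5
  refine exists_isLambda hT (Ξ := fun u₁ u₂ v₁ v₂ => y u₁ v₁ * A u₁ u₂ v₁ v₂ +
    y' u₁ v₁ * B u₁ u₂ v₁ v₂) (C := C) (θ := 3 * α) ?_ ?_ (by linarith) ?_
  · have k : Continuous fun p : Pt T × Pt T × Pt T × Pt T => (p.1, p.2.2.1) := by fun_prop
    exact ((hy.comp k).mul hA.1).add ((hy'.1.comp k).mul hB.1)
  · intro u₁ u₂ u₃ v₁ v₂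
    have h1 := hAcob u₁ u₂ u₃ v₁ v₂
    have h2 := hBcob u₁ u₂ u₃ v₁ v₂
    simp only [cob, du] at h1 h2 ⊢
    linear_combination y u₁ v₁ * h1 + y' u₁ v₁ * h2
  · intro u₁ u₂ u₃ v₁ v₂
    have h1 := hC (u₁, u₂, u₃, v₁, v₂)
    rw [rpow_three_mul (by positivity)]
    rwa [Real.norm_of_nonneg (by positivity : 0 ≤ s (u₁, u₂, u₃, v₁, v₂) ^ 3)] at h1

/-! ### The remainder attached to one direction -/

/-- The part of the remainder of `φ(x)` that is attached to the first direction, for `f = φ'` and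
`gx`, `gw` the `Λ`-parts of the boundary integrals `∫₁ f(x) ∫₂ dx` and `∫₁ f'(x) ∫₂ dω`. The term
with `B` is of second order in both directions; it removes from the coboundary a term that is of
second order only in the first direction. -/
noncomputable def dirRemainder (x : Inc11 T) (X : Data T) (f : ℝ → ℝ) (gx gw : Inc22 T) : Inc22 T :=
  fun u₁ u₂ v₁ v₂ =>
    (f (x u₂ v₁) - f (x u₁ v₁) - deriv f (x u₁ v₁) * du x u₁ u₂ v₁) * dv x u₂ v₁ v₂ -
      deriv (deriv f) (x u₁ v₁) * X.dir₁.H u₁ u₂ v₁ v₂ +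
      deriv (deriv f) (x u₁ v₁) * (dv x u₁ v₁ v₂ * X.dir₁.B .x u₁ u₂ v₁ v₂) -
      gx u₁ u₂ v₁ v₂ - gw u₁ u₂ v₁ v₂

/-- In its own direction, `dirRemainder` has order larger than one: by the relation for `H` and
geometricity, what is left of its first terms is a third order Taylor remainder and `Z`. -/
theorem exists_abs_dirRemainder_le {α β : ℝ} (hα : 1 / 3 < α) (hβ : 0 < β)
    {x : Inc11 T} (hx : Hol11 α β x) {X : Data T} (hF : FinalAlgDir α β x X)
    {f : ℝ → ℝ} (hf : SmoothCompact 4 f) {gx gw : Inc22 T}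
    {hhx hhw : Pt T → Pt T → Pt T → Pt T → Pt T → ℝ} (hgx : IsLambda hhx gx)
    (hgw : IsLambda hhw gw) :
    ∃ μ : ℝ, 1 < μ ∧ ∃ K, ∀ u₁ u₂ v₁ v₂,
      |dirRemainder x X f gx gw u₁ u₂ v₁ v₂| ≤ K * |(u₂ : ℝ) - u₁| ^ μ := by
  obtain ⟨-, -, μx, hμx, Kx, hKx⟩ := hgx
  obtain ⟨-, -, μw, hμw, Kw, hKw⟩ := hgw
  obtain ⟨-, -, μz, hμz, Kz, hKz⟩ := hF.H_eq
  let μ := min (3 * α) (min μx (min μw μz))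
  have hμ : 1 < μ := by simp only [μ, lt_min_iff]; exact ⟨by linarith, hμx, hμw, hμz⟩
  refine ⟨μ, hμ, ?_⟩
  let ι := Pt T × Pt T × Pt T × Pt T
  let u₁ : ι → Pt T := fun i => i.1
  let u₂ : ι → Pt T := fun i => i.2.1
  let v₁ : ι → Pt T := fun i => i.2.2.1
  let v₂ : ι → Pt T := fun i => i.2.2.2
  have lower : ∀ {g : Inc22 T} {ν K : ℝ}, μ ≤ ν →
      (∀ u₁ u₂ v₁ v₂, |g u₁ u₂ v₁ v₂| ≤ K * |(u₂ : ℝ) - u₁| ^ ν) →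
      (fun i => g (u₁ i) (u₂ i) (v₁ i) (v₂ i)) =O[⊤] fun i => |(u₂ i : ℝ) - u₁ i| ^ μ :=
    fun {g ν K} hν hK => (isBigO_top.2 ⟨K, fun i => by
      rw [Real.norm_of_nonneg (by positivity : 0 ≤ |(u₂ i : ℝ) - u₁ i| ^ ν)]
      exact hK _ _ _ _⟩).trans (isBigO_rpow_of_le u₁ u₂ (by linarith) hν)
  have bx := lower (by simp [μ]) hKx
  have bw := lower (by simp [μ]) hKw
  have bz := lower (by simp [μ]) hKz
  have hV := isBigO_rpow_one v₁ v₂ hβ.le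
  have hU3 : (fun i => (|(u₂ i : ℝ) - u₁ i| ^ α) ^ 3) =O[⊤] fun i => |(u₂ i : ℝ) - u₁ i| ^ μ :=
    (isBigO_rpow_of_le u₁ u₂ (by linarith) (min_le_left _ _)).congr_left fun i =>
      rpow_three_mul (abs_nonneg _) _
  have bd := (hx.isBigO_drect u₁ u₂ v₁ v₂).trans ((isBigO_refl _ _).mul hV)
  have bb := (hx.isBigO_dv u₁ v₁ v₂).trans hV
  have ba := hx.isBigO_du u₁ u₂ v₁
  have bs := (hx.sharp_comp (hf.mono (by norm_num : 3 ≤ 4))).isBigO u₁ u₂ v₁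
  have b3 := (hx.comp hf.deriv.deriv).isBigO_one u₁ v₁
  obtain ⟨M, hM⟩ := hf.deriv.deriv.deriv.exists_bound
  have bt : (fun i => f (x (u₂ i) (v₁ i)) - f (x (u₁ i) (v₁ i)) -
      deriv f (x (u₁ i) (v₁ i)) * du x (u₁ i) (u₂ i) (v₁ i) -
      1 / 2 * deriv (deriv f) (x (u₁ i) (v₁ i)) * du x (u₁ i) (u₂ i) (v₁ i) ^ 2) =O[⊤]
      fun i => du x (u₁ i) (u₂ i) (v₁ i) ^ 3 := isBigO_top.2 ⟨M, fun i => by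
    have := abs_taylor_two_le hf.hasDerivAt hf.deriv.hasDerivAt hf.deriv.deriv.hasDerivAt hM
      (x (u₁ i) (v₁ i)) (du x (u₁ i) (u₂ i) (v₁ i))
    rw [show x (u₁ i) (v₁ i) + du x (u₁ i) (u₂ i) (v₁ i) = x (u₂ i) (v₁ i) by
      simp only [du]; ring] at this
    simpa using this⟩
  have c1 := (((bt.trans (ba.pow 3)).trans hU3).mul bb).congr_right fun i => mul_one _
  have c2 := ((bs.mul bd).congr_right (fun i => by rw [rpow_two_mul, mul_one, ← pow_succ])).trans hU3
  have c3 := (b3.mul bz).congr_right fun i => one_mul _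
  obtain ⟨K, hK⟩ := isBigO_top.1 ((((c1.add c2).sub c3).sub bx).sub bw)
  refine ⟨K, fun w₁ w₂ z₁ z₂ => ?_⟩
  have h1 := hK (w₁, w₂, z₁, z₂)
  rw [Real.norm_of_nonneg (by positivity : 0 ≤ |(u₂ (w₁, w₂, z₁, z₂) : ℝ) - u₁ (w₁, w₂, z₁, z₂)| ^ μ),
    Real.norm_eq_abs] at h1
  refine (le_of_eq ?_).trans h1
  congr 1
  have h2 := hF.P_inc_hat w₁ w₂ z₁ z₂
  have h3 := hF.P_geom w₁ w₂ z₁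
  simp only [dirRemainder, u₁, u₂, v₁, v₂]
  simp only [du, dv, drect] at h3 ⊢
  linear_combination deriv (deriv f) (x w₁ z₁) * (x w₁ z₂ - x w₁ z₁) * (-h2 - h3)

/-- The terms of first order in the second direction cancel in the coboundary of `dirRemainder`:
each product on the right has order three in the first direction and two in the second. -/
theorem cob_dirRemainder {α β : ℝ} {x : Inc11 T} {X : Data T} (hAx : X.A .x = drect x)
    (hC : ChenDir α β x X) (hB : BoundaryAlgDir α β x X) (hF : FinalAlgDir α β x X)
    {f : ℝ → ℝ} {gx gw : Inc22 T}
    (hgx : IsLambda (fun u₁ u₂ u₃ v₁ v₂ =>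
      (du (fun u v => f (x u v)) u₁ u₂ v₁ - deriv f (x u₁ v₁) * du x u₁ u₂ v₁) *
          X.A .x u₂ u₃ v₁ v₂ +
        du (fun u v => deriv f (x u v)) u₁ u₂ v₁ * X.dir₁.B .x u₂ u₃ v₁ v₂) gx)
    (hgw : IsLambda (fun u₁ u₂ u₃ v₁ v₂ =>
      (du (fun u v => deriv f (x u v)) u₁ u₂ v₁ - deriv (deriv f) (x u₁ v₁) * du x u₁ u₂ v₁) *
          X.A .w u₂ u₃ v₁ v₂ +
        du (fun u v => deriv (deriv f) (x u v)) u₁ u₂ v₁ * X.dir₁.B .w u₂ u₃ v₁ v₂) gw)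
    (u₁ u₂ u₃ v₁ v₂ : Pt T) :
    cob (fun a b => dirRemainder x X f gx gw a b v₁ v₂) u₁ u₂ u₃ =
      -(((du (fun u v => deriv f (x u v)) u₁ u₂ v₁ - deriv (deriv f) (x u₁ v₁) * du x u₁ u₂ v₁) *
            dv x u₂ v₁ v₂ +
          deriv (deriv f) (x u₁ v₁) * du x u₁ u₂ v₁ * drect x u₁ u₂ v₁ v₂) *
        drect x u₂ u₃ v₁ v₂) -
      1 / 2 * du (fun u v => deriv f (x u v)) u₁ u₂ v₁ * drect x u₂ u₃ v₁ v₂ ^ 2 +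
      (du (fun u v => deriv f (x u v)) u₁ u₂ v₁ - deriv (deriv f) (x u₁ v₁) * du x u₁ u₂ v₁) *
        X.dir₂.I v₁ v₂ u₂ u₃ +
      du (fun u v => deriv (deriv f) (x u v)) u₁ u₂ v₁ * X.dir₁.J u₂ u₃ v₁ v₂ -
      (du (fun u v => deriv (deriv f) (x u v)) u₁ u₂ v₁ * dv x u₂ v₁ v₂ +
        deriv (deriv f) (x u₁ v₁) * drect x u₁ u₂ v₁ v₂) * X.dir₁.B .x u₂ u₃ v₁ v₂ := by
  have k1 := hgx.2.1 u₁ u₂ u₃ v₁ v₂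
  have k2 := hgw.2.1 u₁ u₂ u₃ v₁ v₂
  have k3 := hC.B_cob .x u₁ u₂ u₃ v₁ v₂
  have k4 := hB.H_cob u₁ u₂ u₃ v₁ v₂
  have k5 := hB.A_eq u₂ u₃ v₁ v₂
  have k6 := hB.B_eq u₂ u₃ v₁ v₂
  have k7 := hF.G_eq u₂ u₃ v₁ v₂
  have k8 := hF.P_inc_hat u₂ u₃ v₁ v₂
  rw [hF.P_geom, hF.P_geom] at k8
  rw [hAx] at k1 k3
  simp only [cob, du, dv, drect, dirRemainder] at *
  set φ₁ := deriv f with hφ₁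
  set φ₂ := deriv φ₁ with hφ₂
  linear_combination -k1 - k2 + φ₂ (x u₁ v₁) * (x u₁ v₂ - x u₁ v₁) * k3 - φ₂ (x u₁ v₁) * k4 -
    (φ₁ (x u₂ v₁) - φ₁ (x u₁ v₁) - φ₂ (x u₁ v₁) * (x u₂ v₁ - x u₁ v₁)) * k5 -
    (φ₂ (x u₂ v₁) - φ₂ (x u₁ v₁)) * k6 +
    (φ₁ (x u₂ v₁) - φ₁ (x u₁ v₁)) * k7 + (φ₁ (x u₂ v₁) - φ₁ (x u₁ v₁)) * k8

theorem continuous_comp₂ {Z : Type*} [TopologicalSpace Z] {f : Inc11 T} (hf : Continuous ↿f)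
    {u v : Z → Pt T} (hu : Continuous u) (hv : Continuous v) :
    Continuous fun z => f (u z) (v z) := hf.comp (hu.prodMk hv)

/-- The remainder attached to the first direction is of second order in both directions: its
coboundary is of order three in the first direction and two in the second, and this is passed on to
`dirRemainder` since it has order larger than one in the first direction. -/
theorem hol22_dirRemainder (hT : 0 ≤ T) {α β : ℝ} (hα : 1 / 3 < α) (hβ : 0 < β)
    {x : Inc11 T} (hx : Hol11 α β x) {X : Data T} (hAx : X.A .x = drect x)
    (hC : ChenDir α β x X) (hB : BoundaryAlgDir α β x X) (hI : Hol22 (2 * β) α X.dir₂.I)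
    (hF : FinalAlgDir α β x X) {f : ℝ → ℝ} (hf : SmoothCompact 4 f) {gx gw : Inc22 T}
    (hgx : IsLambda (fun u₁ u₂ u₃ v₁ v₂ =>
      (du (fun u v => f (x u v)) u₁ u₂ v₁ - deriv f (x u₁ v₁) * du x u₁ u₂ v₁) *
          X.A .x u₂ u₃ v₁ v₂ +
        du (fun u v => deriv f (x u v)) u₁ u₂ v₁ * X.dir₁.B .x u₂ u₃ v₁ v₂) gx)
    (hgw : IsLambda (fun u₁ u₂ u₃ v₁ v₂ =>
      (du (fun u v => deriv f (x u v)) u₁ u₂ v₁ - deriv (deriv f) (x u₁ v₁) * du x u₁ u₂ v₁) *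
          X.A .w u₂ u₃ v₁ v₂ +
        du (fun u v => deriv (deriv f) (x u v)) u₁ u₂ v₁ * X.dir₁.B .w u₂ u₃ v₁ v₂) gw) :
    Hol22 (2 * α) (2 * β) (dirRemainder x X f gx gw) := by
  have hα0 : 0 ≤ α := by linarith
  have hcont : Continuous ↿(dirRemainder x X f gx gw) := by
    have p1 : Continuous fun p : Pt T × Pt T × Pt T × Pt T => p.1 := by fun_prop
    have p2 : Continuous fun p : Pt T × Pt T × Pt T × Pt T => p.2.1 := by fun_prop
    have p3 : Continuous fun p : Pt T × Pt T × Pt T × Pt T => p.2.2.1 := by fun_prop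
    have p4 : Continuous fun p : Pt T × Pt T × Pt T × Pt T => p.2.2.2 := by fun_prop
    have c13 := continuous_comp₂ hx.1 p1 p3
    have c14 := continuous_comp₂ hx.1 p1 p4
    have c23 := continuous_comp₂ hx.1 p2 p3
    have c24 := continuous_comp₂ hx.1 p2 p4
    have cf := hf.continuous
    have cf1 := hf.deriv.continuous
    have cf2 := hf.deriv.deriv.continuous
    exact (((((((cf.comp c23).sub (cf.comp c13)).sub ((cf1.comp c13).mul (c23.sub c13))).mul
      (c24.sub c23)).sub ((cf2.comp c13).mul hB.H_mem.1)).add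
      ((cf2.comp c13).mul ((c14.sub c13).mul (hC.B_mem .x).1))).sub hgx.1).sub hgw.1
  obtain ⟨μ, hμ, K, hK⟩ := exists_abs_dirRemainder_le hα hβ hx hF hf hgx hgw
  let ι := Pt T × Pt T × Pt T × Pt T × Pt T
  let u₁ : ι → Pt T := fun i => i.1
  let u₂ : ι → Pt T := fun i => i.2.1
  let u₃ : ι → Pt T := fun i => i.2.2.1
  let v₁ : ι → Pt T := fun i => i.2.2.2.1
  let v₂ : ι → Pt T := fun i => i.2.2.2.2
  -- `s` dominates the increments of order `α` in the first direction, `V` is the weight of the second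
  let s : ι → ℝ := fun i => (|(u₂ i : ℝ) - u₁ i| + |(u₃ i : ℝ) - u₂ i|) ^ α
  let V : ι → ℝ := fun i => |(v₂ i : ℝ) - v₁ i| ^ β
  have hl : (fun i => |(u₂ i : ℝ) - u₁ i| ^ α) =O[⊤] s := rpow_isBigO_left u₁ u₂ u₃ hα0
  have hr : (fun i => |(u₃ i : ℝ) - u₂ i| ^ α) =O[⊤] s := rpow_isBigO_right u₁ u₂ u₃ hα0
  have hV : (fun i => |(v₂ i : ℝ) - v₁ i| ^ β) =O[⊤] V := isBigO_refl _ _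
  have hl2 : (fun i => |(u₂ i : ℝ) - u₁ i| ^ (2 * α)) =O[⊤] fun i => s i ^ 2 :=
    (hl.pow 2).congr_left fun i => (rpow_two_mul _ _).symm
  have hr2 : (fun i => |(u₃ i : ℝ) - u₂ i| ^ (2 * α)) =O[⊤] fun i => s i ^ 2 :=
    (hr.pow 2).congr_left fun i => (rpow_two_mul _ _).symm
  have hV2 : (fun i => |(v₂ i : ℝ) - v₁ i| ^ (2 * β)) =O[⊤] fun i => V i ^ 2 :=
    (hV.pow 2).congr_left fun i => (rpow_two_mul _ _).symm
  have ba := (hx.isBigO_du u₁ u₂ v₁).trans hl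
  have bb := hx.isBigO_dv u₂ v₁ v₂
  have bd := (hx.isBigO_drect u₁ u₂ v₁ v₂).trans (hl.mul hV)
  have bd' := (hx.isBigO_drect u₂ u₃ v₁ v₂).trans (hr.mul hV)
  have b1 := ((hx.comp (hf.deriv.mono (by norm_num : 2 ≤ 3))).isBigO_du u₁ u₂ v₁).trans hl
  have b2 := ((hx.comp hf.deriv.deriv).isBigO_du u₁ u₂ v₁).trans hl
  have b2' := (hx.comp hf.deriv.deriv).isBigO_one u₁ v₁
  have bs := ((hx.sharp_comp hf.deriv).isBigO u₁ u₂ v₁).trans hl2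
  have bI := (hI.isBigO v₁ v₂ u₂ u₃).trans (hV2.mul hr)
  have bJ := (hB.J_mem.isBigO u₂ u₃ v₁ v₂).trans (hr2.mul hV2)
  have bB := ((hC.B_mem .x).isBigO u₂ u₃ v₁ v₂).trans (hr2.mul hV)
  let w : ι → ℝ := fun i => s i ^ 3 * V i ^ 2
  have c1 := (((bs.mul bb).congr_right (g₂ := fun i => s i ^ 2 * V i) fun i => rfl).add
    (((b2'.mul ba).mul bd).congr_right (g₂ := fun i => s i ^ 2 * V i) fun i => by ring)).mul bd'
  have c1' := (c1.congr_right (g₂ := w) fun i => by simp only [w]; ring).neg_left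
  have c2 := ((b1.const_mul_left (1 / 2)).mul (bd'.pow 2)).congr_right (g₂ := w)
    fun i => by simp only [w]; ring
  have c3 := (bs.mul bI).congr_right (g₂ := w) fun i => by simp only [w]; ring
  have c4 := (b2.mul bJ).congr_right (g₂ := w) fun i => by simp only [w]; ring
  have c5 := ((((b2.mul bb).congr_right (g₂ := fun i => s i * V i) fun i => rfl).add
    ((b2'.mul bd).congr_right (g₂ := fun i => s i * V i) fun i => by ring)).mul bB).congr_right
    (g₂ := w) fun i => by simp only [w]; ring
  obtain ⟨M, hM⟩ := isBigO_top.1 ((((c1'.sub c2).add c3).add c4).sub c5)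
  have key : ∀ u₁ u₂ v₁ v₂ : Pt T, |dirRemainder x X f gx gw u₁ u₂ v₁ v₂| ≤
      |M| * (|(v₂ : ℝ) - v₁| ^ β) ^ 2 / (1 - 2 ^ (1 - 3 * α)) * |(u₂ : ℝ) - u₁| ^ (3 * α) := by
    intro u₁ u₂ v₁ v₂
    refine abs_le_of_abs_cob_le hT (g := fun a b => dirRemainder x X f gx gw a b v₁ v₂) hμ
      (by linarith) (fun a b => hK a b v₁ v₂) (fun a b c => ?_) (by positivity) u₁ u₂
    have h1 := hM (a, b, c, v₁, v₂)
    rw [cob_dirRemainder hAx hC hB hF hgx hgw, rpow_three_mul (by positivity)]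
    refine h1.trans ?_
    rw [Real.norm_of_nonneg (by positivity)]
    calc M * (s (a, b, c, v₁, v₂) ^ 3 * V (a, b, c, v₁, v₂) ^ 2)
        ≤ |M| * (s (a, b, c, v₁, v₂) ^ 3 * V (a, b, c, v₁, v₂) ^ 2) := by
          gcongr
          exact le_abs_self M
      _ = _ := by ring
  refine hol22_of_isBigO hcont (IsBigO.trans (g := fun p : Pt T × Pt T × Pt T × Pt T =>
    |(p.2.1 : ℝ) - p.1| ^ (3 * α) * |(p.2.2.2 : ℝ) - p.2.2.1| ^ (2 * β)) ?_
    ((isBigO_rpow_of_le _ _ (by linarith) (by linarith)).mul (isBigO_refl _ _)))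
  refine isBigO_top.2 ⟨|M| / (1 - 2 ^ (1 - 3 * α)), fun p => (key _ _ _ _).trans (le_of_eq ?_)⟩
  rw [Real.norm_of_nonneg (by positivity), rpow_two_mul]
  ring

/-! ### The change of variable formula -/

/-- Only the values of `φ` on a bounded set matter, so that `φ` can be cut off. -/
theorem exists_smoothCompact_eq {n : ℕ} {φ : ℝ → ℝ} (hφ : ContDiff ℝ n φ) (C : ℝ) :
    ∃ f, SmoothCompact n f ∧ ∀ q, |q| ≤ C → f q = φ q := by
  let χ : ContDiffBump (0 : ℝ) := ⟨|C| + 1, |C| + 2, by positivity, by linarith⟩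
  refine ⟨fun q => χ q * φ q, ⟨χ.contDiff.mul hφ, χ.hasCompactSupport.mul_right⟩, fun q hq => ?_⟩
  have h1 : χ q = 1 := χ.one_of_mem_closedBall (by
    rw [mem_closedBall_zero_iff, Real.norm_eq_abs]
    change |q| ≤ |C| + 1
    linarith [le_abs_self C])
  simp only [h1, one_mul]

theorem IsLambda.congr_right {h : Pt T → Pt T → Pt T → Pt T → Pt T → ℝ} {g g' : Inc22 T}
    (hg : IsLambda h g) (e : ∀ u₁ u₂ v₁ v₂, g' u₁ u₂ v₁ v₂ = g u₁ u₂ v₁ v₂) : IsLambda h g' := by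
  obtain rfl : g' = g := by
    funext u₁ u₂ v₁ v₂
    exact e u₁ u₂ v₁ v₂
  exact hg

theorem cob_drect (x : Inc11 T) (u₁ u₂ u₃ v₁ v₂ : Pt T) :
    cob (fun a b => drect x a b v₁ v₂) u₁ u₂ u₃ = 0 := by
  simp only [cob, drect]
  ring

/-- The two-directional Taylor expansion of `f(x)`. -/
theorem Hol11.isBigO_rect_taylor {α β : ℝ} {x : Inc11 T} (hx : Hol11 α β x) {f : ℝ → ℝ}
    (hf : SmoothCompact 4 f) {ι : Type*} (u₁ u₂ v₁ v₂ : ι → Pt T) :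
    (fun i => drect (fun u v => f (x u v)) (u₁ i) (u₂ i) (v₁ i) (v₂ i) -
      ((deriv f (x (u₂ i) (v₁ i)) * dv x (u₂ i) (v₁ i) (v₂ i) -
          deriv f (x (u₁ i) (v₁ i)) * dv x (u₁ i) (v₁ i) (v₂ i)) +
        (deriv f (x (u₁ i) (v₂ i)) * du x (u₁ i) (u₂ i) (v₂ i) -
          deriv f (x (u₁ i) (v₁ i)) * du x (u₁ i) (u₂ i) (v₁ i)) -
        deriv f (x (u₁ i) (v₁ i)) * drect x (u₁ i) (u₂ i) (v₁ i) (v₂ i) -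
        deriv (deriv f) (x (u₁ i) (v₁ i)) *
          (du x (u₁ i) (u₂ i) (v₁ i) * dv x (u₁ i) (v₁ i) (v₂ i)))) =O[⊤]
      fun i => (|(u₂ i : ℝ) - u₁ i| ^ α) ^ 2 * (|(v₂ i : ℝ) - v₁ i| ^ β) ^ 2 := by
  obtain ⟨M₂, hM₂⟩ := hf.deriv.deriv.exists_bound
  obtain ⟨M₃, hM₃⟩ := hf.deriv.deriv.deriv.exists_bound
  obtain ⟨M₄, hM₄⟩ := hf.deriv.deriv.deriv.deriv.exists_bound
  let M := max M₂ (max M₃ M₄)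
  have ba := hx.isBigO_du u₁ u₂ v₁
  have bb := hx.isBigO_dv u₁ v₁ v₂
  have bd := hx.isBigO_drect u₁ u₂ v₁ v₂
  have b := (((ba.norm_left.pow 2).mul (bb.norm_left.pow 2)).add
    ((bd.norm_left.pow 2).congr_right fun i => mul_pow _ _ 2)).add
    (((ba.norm_left.mul bb.norm_left).mul bd.norm_left).congr_right fun i => by ring)
  refine IsBigO.trans (isBigO_top.2 ⟨M, fun i => ?_⟩) b
  have h := abs_rect_taylor_le hf.hasDerivAt hf.deriv.hasDerivAt hf.deriv.deriv.hasDerivAt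
    hf.deriv.deriv.deriv.hasDerivAt (M := M) (fun q => (hM₂ q).trans (le_max_left _ _))
    (fun q => (hM₃ q).trans ((le_max_left _ _).trans (le_max_right _ _)))
    (fun q => (hM₄ q).trans ((le_max_right _ _).trans (le_max_right _ _)))
    (x (u₁ i) (v₁ i)) (du x (u₁ i) (u₂ i) (v₁ i)) (dv x (u₁ i) (v₁ i) (v₂ i))
    (drect x (u₁ i) (u₂ i) (v₁ i) (v₂ i))
  have e1 : x (u₁ i) (v₁ i) + du x (u₁ i) (u₂ i) (v₁ i) + dv x (u₁ i) (v₁ i) (v₂ i) +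
      drect x (u₁ i) (u₂ i) (v₁ i) (v₂ i) = x (u₂ i) (v₂ i) := by
    simp only [du, dv, drect]; ring
  have e2 : x (u₁ i) (v₁ i) + du x (u₁ i) (u₂ i) (v₁ i) = x (u₂ i) (v₁ i) := by
    simp only [du]; ring
  have e3 : x (u₁ i) (v₁ i) + dv x (u₁ i) (v₁ i) (v₂ i) = x (u₁ i) (v₂ i) := by
    simp only [dv]; ring
  rw [e1, e2, e3] at h
  rw [Real.norm_of_nonneg (by positivity : 0 ≤ ‖du x (u₁ i) (u₂ i) (v₁ i)‖ ^ 2 *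
    ‖dv x (u₁ i) (v₁ i) (v₂ i)‖ ^ 2 + ‖drect x (u₁ i) (u₂ i) (v₁ i) (v₂ i)‖ ^ 2 +
    ‖du x (u₁ i) (u₂ i) (v₁ i)‖ * ‖dv x (u₁ i) (v₁ i) (v₂ i)‖ *
    ‖drect x (u₁ i) (u₂ i) (v₁ i) (v₂ i)‖)]
  simp only [Real.norm_eq_abs]
  refine (le_of_eq ?_).trans h
  congr 1
  simp only [du, dv, drect]
  ring

/-- `f(x)` is a controlled sheet with coefficients `f'(x)` and `f''(x)`, for smooth `f` of compact
support. -/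
theorem controlledSheet_comp (hT : 0 ≤ T) {α β : ℝ} (hα : 1 / 3 < α) (hβ : 1 / 3 < β)
    {x : Inc11 T} (hx : Hol11 α β x) {X : Data T} (h₁ : Chen α β x X) (h₂ : BoundaryAlg α β x X)
    (h₄ : FinalAlg α β x X) {f : ℝ → ℝ} (hf : SmoothCompact 5 f) :
    ControlledSheet α β x X fun u v => f (x u v) := by
  have hα0 : 0 < α := by linarith
  have hβ0 : 0 < β := by linarith
  have hAx := h₁.A_x
  have hAx' : X.swap.A .x = drect (swap11 x) := by
    funext v₁ v₂ u₁ u₂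
    simp only [Data.swap, swap22, swap11, hAx, drect]
    ring
  have swapA : ∀ i, Hol22 β α (X.swap.A i) := fun i => by
    obtain ⟨hc, C, hC⟩ := h₁.A_mem i
    refine ⟨hc.comp (f := fun p : Pt T × Pt T × Pt T × Pt T => (p.2.2.1, p.2.2.2, p.1, p.2.1))
      (by fun_prop), C, fun v₁ v₂ u₁ u₂ => (hC u₁ u₂ v₁ v₂).trans (le_of_eq (by ring))⟩
  have px := hx.controlledPath_comp (hf.deriv.mono (by norm_num : 3 ≤ 4))
  have pw := hx.controlledPath_comp hf.deriv.deriv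
  have px' := hx.swap.controlledPath_comp (hf.deriv.mono (by norm_num : 3 ≤ 4))
  have pw' := hx.swap.controlledPath_comp hf.deriv.deriv
  obtain ⟨gx, hgx⟩ := exists_isLambda_boundary hT hα hβ0 px.cont px.coeff₁ px.sharp₁
    (h₁.A_mem .x) (h₁.first.B_mem .x) (by rw [hAx]; exact cob_drect x) (h₁.first.B_cob .x)
  obtain ⟨gw, hgw⟩ := exists_isLambda_boundary hT hα hβ0 pw.cont pw.coeff₁ pw.sharp₁
    (h₁.A_mem .w) (h₁.first.B_mem .w) h₁.first.A_cob (h₁.first.B_cob .w)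
  obtain ⟨gx', hgx'⟩ := exists_isLambda_boundary hT hβ hα0 px'.cont px'.coeff₁ px'.sharp₁
    (swapA .x) (h₁.second.B_mem .x) (by rw [hAx']; exact cob_drect _) (h₁.second.B_cob .x)
  obtain ⟨gw', hgw'⟩ := exists_isLambda_boundary hT hβ hα0 pw'.cont pw'.coeff₁ pw'.sharp₁
    (swapA .w) (h₁.second.B_mem .w) h₁.second.A_cob (h₁.second.B_cob .w)
  have W := hol22_dirRemainder hT hα hβ0 hx hAx h₁.first h₂.first h₂.second.I_mem h₄.first
    hf.deriv hgx hgw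
  have W' := hol22_dirRemainder hT hβ hα0 hx.swap hAx' h₁.second h₂.second h₂.first.I_mem h₄.second
    hf.deriv hgx' hgw'
  refine ⟨⟨_, _, hx.controlledPath_comp (hf.mono (by norm_num : 3 ≤ 5))⟩, _, _, _, _, _, _, px, pw,
    fun u₁ u₂ v₁ v₂ => deriv f (x u₁ v₁) * X.A .x u₁ u₂ v₁ v₂ +
      deriv (deriv f) (x u₁ v₁) * X.dir₁.B .x u₁ u₂ v₁ v₂ + gx u₁ u₂ v₁ v₂,
    fun u₁ u₂ v₁ v₂ => deriv f (x u₁ v₁) * X.A .x u₁ u₂ v₁ v₂ +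
      deriv (deriv f) (x u₁ v₁) * X.dir₂.B .x v₁ v₂ u₁ u₂ + gx' v₁ v₂ u₁ u₂,
    fun u₁ u₂ v₁ v₂ => deriv (deriv f) (x u₁ v₁) * X.A .w u₁ u₂ v₁ v₂ +
      deriv (deriv (deriv f)) (x u₁ v₁) * X.dir₁.B .w u₁ u₂ v₁ v₂ + gw u₁ u₂ v₁ v₂,
    fun u₁ u₂ v₁ v₂ => deriv (deriv f) (x u₁ v₁) * X.A .w u₁ u₂ v₁ v₂ +
      deriv (deriv (deriv f)) (x u₁ v₁) * X.dir₂.B .w v₁ v₂ u₁ u₂ + gw' v₁ v₂ u₁ u₂,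
    ?_, ?_, ?_, ?_, ?_⟩
  · exact hgx.congr_right fun u₁ u₂ v₁ v₂ => by ring
  · exact hgx'.congr_right fun v₁ v₂ u₁ u₂ => by
      simp only [swap11, swap22, Data.swap]
      ring
  · exact hgw.congr_right fun u₁ u₂ v₁ v₂ => by ring
  · exact hgw'.congr_right fun v₁ v₂ u₁ u₂ => by
      simp only [swap11, swap22, Data.swap]
      ring
  · let ι := Pt T × Pt T × Pt T × Pt T
    let u₁ : ι → Pt T := fun p => p.1
    let u₂ : ι → Pt T := fun p => p.2.1
    let v₁ : ι → Pt T := fun p => p.2.2.1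
    let v₂ : ι → Pt T := fun p => p.2.2.2
    refine hol22_of_isBigO ?_ ?_
    · have p1 : Continuous u₁ := continuous_fst
      have p2 : Continuous u₂ := continuous_fst.comp continuous_snd
      have p3 : Continuous v₁ := continuous_fst.comp (continuous_snd.comp continuous_snd)
      have p4 : Continuous v₂ := continuous_snd.comp (continuous_snd.comp continuous_snd)
      have ps : Continuous fun p : Pt T × Pt T × Pt T × Pt T => (p.2.2.1, p.2.2.2, p.1, p.2.1) := by fun_prop
      have c13 := continuous_comp₂ hx.1 p1 p3
      have c14 := continuous_comp₂ hx.1 p1 p4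
      have c23 := continuous_comp₂ hx.1 p2 p3
      have c24 := continuous_comp₂ hx.1 p2 p4
      have cf := hf.continuous
      have cf1 := hf.deriv.continuous.comp c13
      have cf2 := hf.deriv.deriv.continuous.comp c13
      have cf3 := hf.deriv.deriv.deriv.continuous.comp c13
      have cAx := (h₁.A_mem .x).1
      have cAw := (h₁.A_mem .w).1
      exact ((((cf.comp c24).sub (cf.comp c14)).sub (cf.comp c23)).add (cf.comp c13)).sub
        (((((cf1.neg.mul cAx).sub (cf2.mul cAw)).add
          (((cf1.mul cAx).add (cf2.mul (h₁.first.B_mem .x).1)).add hgx.1)).add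
          (((cf1.mul cAx).add (cf2.mul ((h₁.second.B_mem .x).1.comp ps))).add (hgx'.1.comp ps))).add
          (((cf2.mul cAw).add (cf3.mul (h₁.first.B_mem .w).1)).add hgw.1) |>.add
          (((cf2.mul cAw).add (cf3.mul ((h₁.second.B_mem .w).1.comp ps))).add (hgw'.1.comp ps)))
    · let U : ι → ℝ := fun i => |(u₂ i : ℝ) - u₁ i| ^ α
      let V : ι → ℝ := fun i => |(v₂ i : ℝ) - v₁ i| ^ β
      let w : ι → ℝ := fun i => U i ^ 2 * V i ^ 2
      have eU : ∀ i, |(u₂ i : ℝ) - u₁ i| ^ (2 * α) = U i ^ 2 := fun i => rpow_two_mul _ _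
      have eV : ∀ i, |(v₂ i : ℝ) - v₁ i| ^ (2 * β) = V i ^ 2 := fun i => rpow_two_mul _ _
      -- each of the following terms is of second order in both directions; they add up to the
      -- remainder once `A^ω`, `G` and `B^{xω}` are expressed through the other objects
      have bE := hx.isBigO_rect_taylor (hf.mono (by norm_num : 4 ≤ 5)) u₁ u₂ v₁ v₂
      have bW := (W.isBigO u₁ u₂ v₁ v₂).congr_right (g₂ := w) fun i => by rw [eU, eV]
      have bW' := (W'.isBigO v₁ v₂ u₁ u₂).congr_right (g₂ := w) fun i => by rw [eU, eV, mul_comm]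
      have b2 := (hx.comp (hf.deriv.deriv.mono (by norm_num : 2 ≤ 3))).isBigO_one u₁ v₁
      have b3 := (hx.comp hf.deriv.deriv.deriv).isBigO_one u₁ v₁
      have bB := (b3.mul ((hx.isBigO_dv u₁ v₁ v₂).mul
        ((h₁.first.B_mem .x).isBigO u₁ u₂ v₁ v₂))).congr_right (g₂ := w) fun i => by
          rw [eU]; simp only [w, U, V]; ring
      have bB' := (b3.mul ((hx.isBigO_du u₁ u₂ v₁).mul
        ((h₁.second.B_mem .x).isBigO v₁ v₂ u₁ u₂))).congr_right (g₂ := w) fun i => by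
          rw [eV]; simp only [w, U, V]; ring
      have bd := (b2.mul ((hx.isBigO_drect u₁ u₂ v₁ v₂).pow 2)).congr_right (g₂ := w) fun i => by
          simp only [w, U, V]; ring
      have bC := (b2.mul ((h₁.C_mem .x .x).isBigO u₁ u₂ v₁ v₂)).congr_right (g₂ := w) fun i => by
          rw [eU, eV, one_mul]
      have bJ := (b3.mul (h₂.first.J_mem.isBigO u₁ u₂ v₁ v₂)).congr_right (g₂ := w) fun i => by
          rw [eU, eV, one_mul]
      have bJ' := (b3.mul (h₂.second.J_mem.isBigO v₁ v₂ u₁ u₂)).congr_right (g₂ := w) fun i => by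
          rw [eU, eV, one_mul, mul_comm]
      have b := ((((((((bE.add bW).add bW').sub bB).sub bB').sub
        (bd.const_mul_left (1 / 2))).add bC).add bJ).add bJ').congr_right
        (g₂ := fun i => |(u₂ i : ℝ) - u₁ i| ^ (2 * α) * |(v₂ i : ℝ) - v₁ i| ^ (2 * β))
        fun i => by rw [eU, eV]
      refine b.congr_left fun ⟨s₁, s₂, t₁, t₂⟩ => ?_
      have k1 := h₂.first.A_eq s₁ s₂ t₁ t₂
      have k2 := h₄.first.G_eq s₁ s₂ t₁ t₂
      have k3 := h₄.first.P_inc_hat s₁ s₂ t₁ t₂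
      have k4 := h₂.second.I_eq t₁ t₂ s₁ s₂
      have k5 := h₂.first.B_eq s₁ s₂ t₁ t₂
      have k6 := h₂.second.B_eq t₁ t₂ s₁ s₂
      rw [h₄.first.P_geom, h₄.first.P_geom] at k3
      rw [hAx]
      simp only [u₁, u₂, v₁, v₂, dirRemainder]
      simp only [du, dv, drect, swap11, swap22, Data.swap] at *
      linear_combination (deriv (deriv f) (x s₁ t₁)) * (k1 - k2 - k3 - k4) +
        deriv (deriv (deriv f)) (x s₁ t₁) * (k5 + k6)

end RoughSheet

theorem mainTheorem5 (T α β : ℝ) (hT : 0 < T) (hα : 1 / 3 < α) (hβ : 1 / 3 < β)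
    (x : RoughSheet.Inc11 T) (hx : RoughSheet.Hol11 α β x)
    (X : RoughSheet.Data T)
    (h₁ : RoughSheet.Chen α β x X)
    (h₂ : RoughSheet.BoundaryAlg α β x X)
    (h₃ : RoughSheet.InterpolationAlg α β x X)
    (h₄ : RoughSheet.FinalAlg α β x X)
    (φ : ℝ → ℝ) (hφ : ContDiff ℝ 5 φ) :
    RoughSheet.ControlledSheet α β x X (fun s t => φ (x s t)) := by
  obtain ⟨-, C, hC, -⟩ := id hx
  obtain ⟨f, hf, hfφ⟩ := RoughSheet.exists_smoothCompact_eq (n := 5) (by exact_mod_cast hφ) C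
  have e : (fun s t => φ (x s t)) = fun s t => f (x s t) := by
    funext s t
    exact (hfφ _ (hC s t)).symm
  rw [e]
  exact RoughSheet.controlledSheet_comp hT.le hα hβ hx h₁ h₂ h₄ hf
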